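/- Let $s\ge 1$ and $N\ge 2$ be integers, $\alpha>1/2$ and $\boldsymbol\gamma=(\gamma_1,\dots,\gamma_s)$ with all $\gamma_j>0$. For $h\in\mathbb Z$ and $\gamma>0$ put $r_{\alpha,\gamma}(0)=1$ and $r_{\alpha,\gamma}(h)=\gamma|h|^{-2\alpha}$ for $h\ne0$. On $[0,1]^s$ consider the half-period cosine kernel and the Korobov kernel $$K^{\cos}_{\alpha,\boldsymbol\gamma,s}(\boldsymbol x,\boldsymbol y)=\prod_{j=1}^s\Big(1+\sum_{k=1}^\infty r_{\alpha,\gamma_j}(k)\,\sqrt2\cos(\pi kx_j)\,\sqrt2\cos(\pi ky_j)\Big),\qquad K^{\rm kor}_{\alpha,\boldsymbol\gamma,s}(\boldsymbol x,\boldsymbol y)=\prod_{j=1}^s\sum_{h\in\mathbb Z}r_{\alpha,\gamma_j}(h)\,e^{2\pi i h(x_j-y_j)} .$$ For a reproducing kernel $K$ on $[0,1]^s$ let $\mathcal H(K)$ be its (real) reproducing kernel Hilbert space, and for points $P=(\boldsymbol x_0,\dots,\boldsymbol x_{N-1})$ let $$e(\mathcal H(K);P)=\sup_{f\in\mathcal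 H(K),\ \|f\|_K\le1}\Big|\int_{[0,1]^s}f(\boldsymbol x)\,d\boldsymbol x-\frac1N\sum_{n=0}^{N-1}f(\boldsymbol x_n)\Big| .$$ For $\boldsymbol g\in\{1,\dots,N-1\}^s$ let $P(\boldsymbol g,N)$ consist of the points $\{n\boldsymbol g/N\}$, $0\le n<N$ (componentwise fractional parts), and let $P_\phi(\boldsymbol g,N)$ consist of their images under the tent transformation $\phi(x)=1-|2x-1|$, applied componentwise. The component-by-component construction chooses $g_1,g_2,\dots,g_s$ one after the other: given $g_1,\dots,g_{d-1}$, the component $g_d\in\{1,\dots,N-1\}$ is chosen so as to minimize a quality criterion for $(g_1,\dots,g_d)$ (ties are broken arbitrarily). The criterion is either the worst-case error of the lattice rule in the Korobov space, $e(\mathcal H(K^{\rm kor}_{\alpha,(\gamma_1,\dots,\gamma_d),d});P((g_1,\dots,g_d),N))$, which is the one used by the fast version of the algorithm, or the worst-case error of the tent-transformed rule, $e(\mathcal H(K^{\cos}_{\alpha,(\gamma_1,\dots,\gamma_d),d});P_\phi((g_1,\dots,g_d),N))$. With either criterion such a vector $\boldsymbol g$ exists, and every vector $\boldsymbol g\in\{1,\dots,N-1\}^s$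 constructed in this way satisfies, simultaneously for all real $\tau$ with $1\le\tau<2\alpha$, $$e(\mathcal H(K^{\cos}_{\alpha,\boldsymbol\gamma,s});P_\phi(\boldsymbol g,N))\le C_{\alpha,\boldsymbol\gamma,s,\tau}\,(N-1)^{-\tau/2},$$ where the constant $C_{\alpha,\boldsymbol\gamma,s,\tau}>0$ is given, with $\gamma_{\mathfrak u}=\prod_{j\in\mathfrak u}\gamma_j$ and the Riemann zeta function $\zeta$, by $$C_{\alpha,\boldsymbol\gamma,s,\tau}=\Big(\sum_{\emptyset\ne\mathfrak u\subseteq\{1,\dots,s\}}\gamma_{\mathfrak u}^{1/\tau}\,(2\zeta(2\alpha/\tau))^{|\mathfrak u|}\Big)^{\tau/2}=\Big(-1+\prod_{j=1}^s\big(1+2\zeta(2\alpha/\tau)\gamma_j^{1/\tau}\big)\Big)^{\tau/2}.$$ -/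

import Mathlib

open scoped ENNReal unitInterval

noncomputable section

namespace TentLattice

/-! ### Positive semidefinite real kernels -/

/-- A real kernel `K : X × X → ℝ`, seen as an operator-valued matrix as in Mathlib's theory of
reproducing kernel Hilbert spaces. -/
def kernelMatrix {X : Type*} (K : X → X → ℝ) : Matrix X X (ℝ →L[ℝ] ℝ) :=
  Matrix.of fun x y => K x y • ContinuousLinearMap.id ℝ ℝ

/-- Symmetric positive semidefinite kernels. -/
def IsPSDKernel {X : Type*} (K : X → X → ℝ) : Prop :=
  (∀ x y, K x y = K y x) ∧
    ∀ (t : Finset X) (c : X → ℝ), 0 ≤ ∑ x ∈ t, ∑ y ∈ t, c x * c y * K x y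

theorem IsPSDKernel.posSemidef {X : Type*} {K : X → X → ℝ} (h : IsPSDKernel K) :
    (kernelMatrix K).PosSemidef := by
  have key := (RKHS.posSemidef_tfae (K := kernelMatrix K)).out 0 2
  refine key.mpr (And.intro ?_ fun v => ?_)
  · ext x y
    have hid : ContinuousLinearMap.adjoint (ContinuousLinearMap.id ℝ ℝ) =
        ContinuousLinearMap.id ℝ ℝ := star_one (ℝ →L[ℝ] ℝ)
    simp [kernelMatrix, ContinuousLinearMap.star_eq_adjoint, h.1 x y, hid]
  · have := h.2 v.support v
    simp only [kernelMatrix, Finsupp.sum, Matrix.of_apply]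
    refine this.trans (le_of_eq ?_)
    simp only [RCLike.re_to_real]
    refine Finset.sum_congr rfl fun x _ => Finset.sum_congr rfl fun y _ => ?_
    simp [h.1 y x]
    ring

/-- Kernels whose pointwise product with every positive semidefinite kernel is positive
semidefinite (auxiliary, for the proofs that the kernels below are positive semidefinite). -/
def IsSchurKernel {X : Type*} (K : X → X → ℝ) : Prop :=
  ∀ L : X → X → ℝ, IsPSDKernel L → IsPSDKernel fun x y => L x y * K x y

theorem isPSDKernel_one {X : Type*} : IsPSDKernel fun _ _ : X => (1 : ℝ) := by
  refine ⟨fun _ _ => rfl, fun t c => ?_⟩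
  have : ∑ x ∈ t, ∑ y ∈ t, c x * c y * (1 : ℝ) = (∑ x ∈ t, c x) * ∑ y ∈ t, c y := by
    simp [Finset.sum_mul_sum]
  rw [this]
  exact mul_self_nonneg _

theorem isSchurKernel_feature {X : Type*} {a : ℝ} (ha : 0 ≤ a) (p : X → ℝ) :
    IsSchurKernel fun x y => a * (p x * p y) := by
  refine fun L hL => ⟨fun x y => by simp only [hL.1 x y]; ring, fun t c => ?_⟩
  have := mul_nonneg ha (hL.2 t fun x => c x * p x)
  refine this.trans (le_of_eq ?_)
  simp only [Finset.mul_sum]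
  refine Finset.sum_congr rfl fun x _ => Finset.sum_congr rfl fun y _ => ?_
  ring

theorem IsSchurKernel.add {X : Type*} {K K' : X → X → ℝ} (h : IsSchurKernel K)
    (h' : IsSchurKernel K') : IsSchurKernel fun x y => K x y + K' x y := by
  refine fun L hL => ⟨fun x y => ?_, fun t c => ?_⟩
  · simp only [mul_add]
    exact congrArg₂ (· + ·) ((h L hL).1 x y) ((h' L hL).1 x y)
  · refine (add_nonneg ((h L hL).2 t c) ((h' L hL).2 t c)).trans (le_of_eq ?_)
    simp only [← Finset.sum_add_distrib, mul_add]

theorem IsSchurKernel.hasSum {X ι : Type*} {F : ι → X → X → ℝ} {K : X → X → ℝ}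
    (h : ∀ i, IsSchurKernel (F i)) (hs : ∀ x y, HasSum (fun i => F i x y) (K x y)) :
    IsSchurKernel K := by
  refine fun L hL => ⟨fun x y => ?_, fun t c => ?_⟩
  · refine ((hs x y).mul_left (L x y)).unique ?_
    have := (hs y x).mul_left (L y x)
    refine this.congr_fun fun i => ?_
    exact (h i L hL).1 x y
  · have : HasSum (fun i => ∑ x ∈ t, ∑ y ∈ t, c x * c y * (L x y * F i x y))
        (∑ x ∈ t, ∑ y ∈ t, c x * c y * (L x y * K x y)) :=
      hasSum_sum fun x _ => hasSum_sum fun y _ => ((hs x y).mul_left _).mul_left _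
    exact this.nonneg fun i => (h i L hL).2 t c

theorem IsSchurKernel.one_isPSD {X : Type*} {K : X → X → ℝ} (h : IsSchurKernel K) :
    IsPSDKernel K := by
  simpa using h _ isPSDKernel_one

theorem IsSchurKernel.prod {X ι : Type*} (t : Finset ι) {F : ι → X → X → ℝ}
    (h : ∀ i, IsSchurKernel (F i)) : IsPSDKernel fun x y => ∏ i ∈ t, F i x y := by
  classical
  induction t using Finset.induction_on with
  | empty => simpa using isPSDKernel_one
  | insert i t hi ih =>
    have := h i _ ih
    simpa [Finset.prod_insert hi, mul_comm] using this

/-! ### Worst-case error of quasi-Monte Carlo rules -/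

/-- The worst-case error `e(H(K); P)` of the equal-weight rule with nodes `P 0, …, P (N - 1)`
(counted with multiplicity) in the reproducing kernel Hilbert space `H(K)` of functions
`[0,1]^s → ℝ`. -/
def worstCaseError {s N : ℕ} (K : (Fin s → I) → (Fin s → I) → ℝ) (hK : IsPSDKernel K)
    (P : Fin N → Fin s → I) : ℝ≥0∞ :=
  haveI : Fact (kernelMatrix K).PosSemidef := ⟨hK.posSemidef⟩
  ⨆ (f : RKHS.OfKernel (kernelMatrix K)) (_ : ‖f‖ ≤ 1),
    ENNReal.ofReal |(∫ x : Fin s → I, f x) - (1 / (N : ℝ)) * ∑ n : Fin N, f (P n)|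

/-! ### The Korobov kernel and the half-period cosine kernel -/

/-- `r_{α,γ}(h) = 1` for `h = 0` and `γ |h| ^ (-2α)` otherwise. -/
def r (α γ : ℝ) (h : ℤ) : ℝ := if h = 0 then 1 else γ * |(h : ℝ)| ^ (-(2 * α))

/-- The one-dimensional Korobov kernel (its values are real). -/
def korKernel₁ (α γ : ℝ) (x y : I) : ℝ :=
  (∑' h : ℤ, (r α γ h : ℂ) *
    Complex.exp (2 * Real.pi * Complex.I * h * ((x : ℝ) - (y : ℝ)))).re

/-- The one-dimensional half-period cosine kernel. -/
def cosKernel₁ (α γ : ℝ) (x y : I) : ℝ :=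
  1 + ∑' k : ℕ, r α γ ((k : ℤ) + 1) *
    (√2 * Real.cos (Real.pi * (k + 1) * x)) * (√2 * Real.cos (Real.pi * (k + 1) * y))

def korKernel {s : ℕ} (α : ℝ) (γ : Fin s → ℝ) (x y : Fin s → I) : ℝ :=
  ∏ j, korKernel₁ α (γ j) (x j) (y j)

def cosKernel {s : ℕ} (α : ℝ) (γ : Fin s → ℝ) (x y : Fin s → I) : ℝ :=
  ∏ j, cosKernel₁ α (γ j) (x j) (y j)

theorem r_nonneg {α γ : ℝ} (hγ : 0 < γ) (h : ℤ) : 0 ≤ r α γ h := by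
  unfold r
  split_ifs
  · exact zero_le_one
  · positivity

theorem summable_r {α γ : ℝ} (hα : 1 / 2 < α) : Summable (r α γ) := by
  have h1 : Summable fun h : ℤ => γ * |(h : ℝ)| ^ (-(2 * α)) :=
    (Real.summable_abs_int_rpow (b := 2 * α) (by linarith)).mul_left γ
  refine (summable_congr_cofinite ?_).mpr h1
  refine Filter.mem_of_superset (Set.finite_singleton (0 : ℤ)).compl_mem_cofinite fun h hh => ?_
  simp only [Set.mem_compl_iff, Set.mem_singleton_iff] at hh
  simp [r, hh]

theorem isSchurKernel_korKernel₁ {X : Type*} {α γ : ℝ} (hα : 1 / 2 < α) (hγ : 0 < γ)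
    (q : X → I) : IsSchurKernel fun x y => korKernel₁ α γ (q x) (q y) := by
  refine IsSchurKernel.hasSum (ι := ℤ) (F := fun h x y =>
    r α γ h * (Real.cos (2 * Real.pi * h * q x) * Real.cos (2 * Real.pi * h * q y)) +
    r α γ h * (Real.sin (2 * Real.pi * h * q x) * Real.sin (2 * Real.pi * h * q y)))
    (fun h => (isSchurKernel_feature (r_nonneg hγ h) _).add
      (isSchurKernel_feature (r_nonneg hγ h) _)) fun x y => ?_
  have key : ∀ h : ℤ, Complex.exp (2 * Real.pi * Complex.I * h * ((q x : ℝ) - (q y : ℝ))) =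
      Complex.exp (((2 * Real.pi * h * ((q x : ℝ) - (q y : ℝ)) : ℝ) : ℂ) * Complex.I) := by
    intro h
    congr 1
    push_cast
    ring
  have hs : Summable fun h : ℤ => (r α γ h : ℂ) *
      Complex.exp (2 * Real.pi * Complex.I * h * ((q x : ℝ) - (q y : ℝ))) := by
    refine Summable.of_norm_bounded (summable_r (γ := γ) hα) fun h => ?_
    rw [key, norm_mul, Complex.norm_exp_ofReal_mul_I, mul_one, Complex.norm_real,
      Real.norm_of_nonneg (r_nonneg hγ h)]
  refine (Complex.hasSum_re hs.hasSum).congr_fun fun h => ?_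
  rw [key, Complex.re_ofReal_mul, Complex.exp_ofReal_mul_I_re, mul_sub, Real.cos_sub]
  ring

theorem isSchurKernel_cosKernel₁ {X : Type*} {α γ : ℝ} (hα : 1 / 2 < α) (hγ : 0 < γ)
    (q : X → I) : IsSchurKernel fun x y => cosKernel₁ α γ (q x) (q y) := by
  have h1 : IsSchurKernel fun _ _ : X => (1 : ℝ) := fun L hL => by simpa using hL
  refine h1.add (IsSchurKernel.hasSum (ι := ℕ) (F := fun k x y => r α γ ((k : ℤ) + 1) *
    ((√2 * Real.cos (Real.pi * (k + 1) * q x)) * (√2 * Real.cos (Real.pi * (k + 1) * q y))))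
    (fun k => isSchurKernel_feature (r_nonneg hγ _) _) fun x y => ?_)
  have hr : Summable fun k : ℕ => r α γ ((k : ℤ) + 1) :=
    (summable_r (γ := γ) hα).comp_injective (i := fun k : ℕ => (k : ℤ) + 1)
      fun a b h => by simpa using h
  have hs : Summable fun k : ℕ => r α γ ((k : ℤ) + 1) *
      (√2 * Real.cos (Real.pi * (k + 1) * q x)) * (√2 * Real.cos (Real.pi * (k + 1) * q y)) := by
    refine Summable.of_norm_bounded (hr.mul_right 2) fun k => ?_
    have hc := mul_le_one₀ (Real.abs_cos_le_one (Real.pi * (k + 1) * q x)) (abs_nonneg _)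
      (Real.abs_cos_le_one (Real.pi * (k + 1) * q y))
    have h2 : √(2 : ℝ) * √2 = 2 := Real.mul_self_sqrt (by norm_num)
    have : ‖r α γ ((k : ℤ) + 1) * (√2 * Real.cos (Real.pi * (k + 1) * q x)) *
        (√2 * Real.cos (Real.pi * (k + 1) * q y))‖ = r α γ ((k : ℤ) + 1) * (√2 * √2 *
          (|Real.cos (Real.pi * (k + 1) * q x)| * |Real.cos (Real.pi * (k + 1) * q y)|)) := by
      simp only [norm_mul, Real.norm_eq_abs, abs_of_nonneg (r_nonneg (α := α) hγ ((k : ℤ) + 1)),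
        abs_of_nonneg (Real.sqrt_nonneg 2)]
      ring
    rw [this, h2]
    exact mul_le_mul_of_nonneg_left (by linarith) (r_nonneg hγ _)
  exact hs.hasSum.congr_fun fun k => by ring

theorem isPSDKernel_korKernel {s : ℕ} {α : ℝ} (hα : 1 / 2 < α) {γ : Fin s → ℝ}
    (hγ : ∀ j, 0 < γ j) : IsPSDKernel (korKernel α γ) :=
  IsSchurKernel.prod Finset.univ
    (F := fun j (x y : Fin s → I) => korKernel₁ α (γ j) (x j) (y j))
    fun j => isSchurKernel_korKernel₁ hα (hγ j) fun x : Fin s → I => x j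

theorem isPSDKernel_cosKernel {s : ℕ} {α : ℝ} (hα : 1 / 2 < α) {γ : Fin s → ℝ}
    (hγ : ∀ j, 0 < γ j) : IsPSDKernel (cosKernel α γ) :=
  IsSchurKernel.prod Finset.univ
    (F := fun j (x y : Fin s → I) => cosKernel₁ α (γ j) (x j) (y j))
    fun j => isSchurKernel_cosKernel₁ hα (hγ j) fun x : Fin s → I => x j

/-! ### Lattice rules and tent-transformed lattice rules -/

/-- The lattice points `{n g / N}`, `0 ≤ n < N`. -/
def latticePoints {s : ℕ} (g : Fin s → ℕ) (N : ℕ) (n : Fin N) (j : Fin s) : I :=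
  ⟨Int.fract ((n : ℝ) * (g j : ℝ) / (N : ℝ)), unitInterval.fract_mem _⟩

/-- The tent transformation `φ(x) = 1 - |2x - 1|`. -/
def tent (x : I) : I :=
  ⟨1 - |2 * (x : ℝ) - 1|, by
    have h : |2 * (x : ℝ) - 1| ≤ 1 := abs_le.mpr ⟨by linarith [x.2.1], by linarith [x.2.2]⟩
    exact ⟨by linarith, by linarith [abs_nonneg (2 * (x : ℝ) - 1)]⟩⟩

/-- The tent-transformed lattice points. -/
def tentLatticePoints {s : ℕ} (g : Fin s → ℕ) (N : ℕ) (n : Fin N) (j : Fin s) : I :=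
  tent (latticePoints g N n j)

/-- `e(H(K^kor_{α,γ,s}); P(g,N))`. -/
def korError {s : ℕ} (N : ℕ) {α : ℝ} (hα : 1 / 2 < α) {γ : Fin s → ℝ} (hγ : ∀ j, 0 < γ j)
    (g : Fin s → ℕ) : ℝ≥0∞ :=
  worstCaseError (korKernel α γ) (isPSDKernel_korKernel hα hγ) (latticePoints g N)

/-- `e(H(K^cos_{α,γ,s}); P_φ(g,N))`. -/
def cosError {s : ℕ} (N : ℕ) {α : ℝ} (hα : 1 / 2 < α) {γ : Fin s → ℝ} (hγ : ∀ j, 0 < γ j)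
    (g : Fin s → ℕ) : ℝ≥0∞ :=
  worstCaseError (cosKernel α γ) (isPSDKernel_cosKernel hα hγ) (tentLatticePoints g N)

/-! ### Component-by-component construction -/

/-- `g` is an output of the component-by-component algorithm with quality criterion `err`
(`err d _ z` is the criterion for a `d`-dimensional generating vector `z`): one component after
the other is chosen in `{1, …, N - 1}`, the preceding ones being kept fixed, so as to minimize the
criterion in the current dimension. Ties may be broken in any way. -/
def IsCBC (s N : ℕ) (err : (d : ℕ) → d ≤ s → (Fin d → ℕ) → ℝ≥0∞) (g : Fin s → ℕ) : Prop :=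
  ∀ (d : ℕ) (hd : d < s), g ⟨d, hd⟩ ∈ Finset.Icc 1 (N - 1) ∧
    ∀ z ∈ Finset.Icc 1 (N - 1),
      err (d + 1) hd (fun i => g (Fin.castLE hd i)) ≤
        err (d + 1) hd (Fin.snoc (α := fun _ => ℕ) (fun i : Fin d => g (Fin.castLE hd.le i)) z)

/-- Component-by-component construction with the worst-case error of the lattice rule in the
Korobov space as criterion (the criterion evaluated by the fast algorithm). -/
def IsKorCBC {s : ℕ} (N : ℕ) {α : ℝ} (hα : 1 / 2 < α) {γ : Fin s → ℝ} (hγ : ∀ j, 0 < γ j)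
    (g : Fin s → ℕ) : Prop :=
  IsCBC s N (fun _ h => korError N hα (γ := fun j => γ (Fin.castLE h j)) fun _ => hγ _) g

/-- Component-by-component construction with the worst-case error of the tent-transformed lattice
rule in the half-period cosine space as criterion. -/
def IsCosCBC {s : ℕ} (N : ℕ) {α : ℝ} (hα : 1 / 2 < α) {γ : Fin s → ℝ} (hγ : ∀ j, 0 < γ j)
    (g : Fin s → ℕ) : Prop :=
  IsCBC s N (fun _ h => cosError N hα (γ := fun j => γ (Fin.castLE h j)) fun _ => hγ _) g

/-! ### The constant -/

/-- The Riemann zeta function at a real argument (real-valued there). -/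
def zetaReal (x : ℝ) : ℝ := (riemannZeta (x : ℂ)).re

/-- `C_{α,γ,s,τ}`, as a sum over the nonempty subsets of `{1, …, s}`,
with `γ_u = ∏_{j ∈ u} γ_j`. -/
def boundConst {s : ℕ} (α : ℝ) (γ : Fin s → ℝ) (τ : ℝ) : ℝ :=
  (∑ u : Finset (Fin s) with u.Nonempty,
    (∏ j ∈ u, γ j) ^ (1 / τ) * (2 * zetaReal (2 * α / τ)) ^ u.card) ^ (τ / 2)

end TentLattice

end

open scoped ENNReal unitInterval

noncomputable section

namespace TentLattice

/-! The squared worst-case error of an equal-weight rule is the mean of `K` over all pairs of nodes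
minus 1, because the kernels integrate to 1 in one variable. At lattice nodes only frequencies
modulo `N` matter, so with `residueWeight` both squared errors become `gridSum φ ρ z - 1`: a sum
over the `c` in `ZMod N` with `c ⬝ z = 0`, damped by averages of `φ`. Here `φ = 1` gives the Korobov
error. The tent map turns `cos (π k x)` into `cos (2 π k x)`, so the cosine error has the same form
with `φ = charCos`. As `|charCos| ≤ 1`, the Korobov error dominates the cosine error, and a single
induction, over a general `φ` with `|φ| ≤ 1` and `φ 0 = 1`, serves both criteria.

Appending a component `g` raises `gridSum` by at most `T = ∑ b, θ b * dualWeight (-(b * g))`, where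
`θ` collects the nonzero frequencies (`gridSum_succ_le`). Put `p = 1 / τ`. Subadditivity of `t ↦ t ^
p` bounds `T ^ p` by the same sum with `α, γ` replaced by `α p, γ ^ p`, and some `g ≠ 0` makes this
at most its average. Hence `(N - 1) * E ^ p ≤ ∏ (1 + 2 ζ γ_j ^ p) - 1` propagates from dimension to
dimension. The chosen vector does not depend on `p`, so all `τ` are covered at once.

The delicate point is the average for composite `N`: multiples `h g` with `h` not coprime to `N` hit
a proper subgroup repeatedly, and the uniform average over `g ≠ 0` can exceed the desired bound. The
average is therefore taken with the weights `primeWeight`, which sieve out precisely these `h`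
(`exists_ne_zero_multiplesSum_le`). -/

/-- The Dirichlet-type series `∑ h^(-a) W(h g)` along the multiples of `g`. -/
def multiplesSum {N : ℕ} (a : ℝ) (W : ZMod N → ℝ) (g : ZMod N) : ℝ :=
  ∑' h : ℕ, (h : ℝ) ^ (-a) * W (h * g)

/-! ### Sieve-weighted averaging over generators modulo a composite number -/

section Averaging

variable {N : ℕ} [NeZero N]

theorem summable_nat_rpow_mul {a : ℝ} (ha : 1 < a) {G : ℕ → ℝ} {B : ℝ} (hG : ∀ h, |G h| ≤ B) :
    Summable fun h : ℕ => (h : ℝ) ^ (-a) * G h := by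
  refine Summable.of_norm_bounded ((Real.summable_nat_rpow.mpr (by linarith : -a < -1)).mul_right B)
    fun h => ?_
  rw [norm_mul, Real.norm_of_nonneg (by positivity), Real.norm_eq_abs]
  exact mul_le_mul_of_nonneg_left (hG h) (by positivity)

theorem exists_abs_le (W : ZMod N → ℝ) : ∃ B, ∀ c, |W c| ≤ B :=
  ⟨∑ c, |W c|, fun c => Finset.single_le_sum (f := fun c => |W c|)
    (fun _ _ => abs_nonneg _) (Finset.mem_univ c)⟩

theorem summable_multiplesSum {a : ℝ} (ha : 1 < a) (W : ZMod N → ℝ) (g : ZMod N) :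
    Summable fun h : ℕ => (h : ℝ) ^ (-a) * W (h * g) :=
  have ⟨_, hB⟩ := exists_abs_le W
  summable_nat_rpow_mul ha fun h => hB (h * g)

/-- The number of solutions of `p x = 0` in `ZMod N`. -/
def kerCard (N p : ℕ) [NeZero N] : ℕ := (Finset.univ.filter fun x : ZMod N => (p : ZMod N) * x = 0).card

theorem kerCard_le {p : ℕ} (hp : 0 < p) : kerCard N p ≤ p := by
  have := IsAddCyclic.card_nsmul_eq_zero_le (α := ZMod N) hp
  simpa [kerCard, nsmul_eq_mul] using this

/-- A nonempty fibre of multiplication by `p` is a translate of its kernel. -/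
theorem card_fiber (p : ℕ) (g : ZMod N) [Decidable ((p : ZMod N) ∣ g)] :
    (Finset.univ.filter fun x : ZMod N => (p : ZMod N) * x = g).card =
      if (p : ZMod N) ∣ g then kerCard N p else 0 := by
  split_ifs with h
  · obtain ⟨y, rfl⟩ := h
    refine Finset.card_bij' (fun x _ => x - y) (fun x _ => x + y) ?_ ?_ ?_ ?_ <;>
      simp +contextual [mul_sub, mul_add]
  · rw [Finset.card_eq_zero, Finset.filter_eq_empty_iff]
    exact fun x _ hx => h ⟨x, hx.symm⟩

open Classical in
theorem sum_mul_left_eq (p : ℕ) (G : ZMod N → ℝ) :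
    ∑ b, G (p * b) = ∑ g, (if (p : ZMod N) ∣ g then (kerCard N p : ℝ) else 0) * G g := by
  rw [← Finset.sum_fiberwise Finset.univ (fun b : ZMod N => (p : ZMod N) * b)]
  refine Finset.sum_congr rfl fun g _ => ?_
  rw [Finset.sum_congr rfl (g := fun _ => G g)
    (fun b hb => by rw [(Finset.mem_filter.mp hb).2]), Finset.sum_const, card_fiber, nsmul_eq_mul]
  split_ifs <;> simp

open Classical in
/-- Nonnegative weights on `ZMod N` which are smaller at elements with many prime divisors. -/
def primeWeight (a : ℝ) (P : Finset ℕ) (g : ZMod N) : ℝ :=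
  ∏ p ∈ P, (1 - (p : ℝ) ^ (-a) * if (p : ZMod N) ∣ g then (kerCard N p : ℝ) else 0)

/-- The kernel has at most `p` elements and `p ^ (1 - a) ≤ 1`. This keeps every factor of
`primeWeight` nonnegative. -/
theorem rpow_mul_kerCard_le {a : ℝ} (ha : 1 < a) {p : ℕ} (hp : p.Prime) :
    (p : ℝ) ^ (-a) * kerCard N p ≤ 1 := by
  have hp0 : (0 : ℝ) < p := by exact_mod_cast hp.pos
  have h1 : (kerCard N p : ℝ) ≤ p := by exact_mod_cast kerCard_le hp.pos
  calc (p : ℝ) ^ (-a) * kerCard N p ≤ (p : ℝ) ^ (-a) * p := by gcongr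
    _ = (p : ℝ) ^ (-a + 1) := by rw [Real.rpow_add_one hp0.ne']
    _ ≤ 1 := Real.rpow_le_one_of_one_le_of_nonpos (by exact_mod_cast hp.one_le) (by linarith)

theorem primeWeight_nonneg {a : ℝ} (ha : 1 < a) {P : Finset ℕ} (hP : ∀ p ∈ P, p.Prime)
    (g : ZMod N) : 0 ≤ primeWeight a P g := by
  refine Finset.prod_nonneg fun p hp => ?_
  have := rpow_mul_kerCard_le (N := N) ha (hP p hp)
  split_ifs
  · linarith
  · simp

/-- Every `p` divides 0, so each factor takes its smaller value there. Consequently discarding `g =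
0` costs at most the fraction `1 / N` of the total weight. -/
theorem primeWeight_zero_le {a : ℝ} (ha : 1 < a) {P : Finset ℕ} (hP : ∀ p ∈ P, p.Prime)
    (g : ZMod N) : primeWeight a P (0 : ZMod N) ≤ primeWeight a P g := by
  refine Finset.prod_le_prod (fun p hp => ?_) fun p hp => ?_
  · have := rpow_mul_kerCard_le (N := N) ha (hP p hp)
    simpa using this
  · have : 0 ≤ (p : ℝ) ^ (-a) * (kerCard N p : ℝ) := by positivity
    split_ifs <;> simp_all

/-- Distinct primes remain coprime in `ZMod N`, by the Bézout identity. -/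
theorem primeWeight_mul_left {a : ℝ} {P : Finset ℕ} (hP : ∀ p ∈ P, p.Prime) {p : ℕ}
    (hp : p.Prime) (hpP : p ∉ P) (g : ZMod N) :
    primeWeight a P ((p : ZMod N) * g) = primeWeight a P g := by
  refine Finset.prod_congr rfl fun q hq => ?_
  have hcop : IsCoprime (q : ZMod N) (p : ZMod N) := by
    have : Nat.Coprime q p := (Nat.coprime_primes (hP q hq) hp).mpr fun h => hpP (h ▸ hq)
    simpa using (Nat.isCoprime_iff_coprime.mpr this).map (Int.castRingHom (ZMod N))
  have : (q : ZMod N) ∣ p * g ↔ (q : ZMod N) ∣ g :=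
    ⟨hcop.dvd_of_dvd_mul_left, fun h => h.mul_left _⟩
  simp only [this]

theorem multiplesSum_mul_left {N : ℕ} (a : ℝ) (W : ZMod N → ℝ) (c g : ZMod N) :
    multiplesSum a W (c * g) = multiplesSum a (fun x => W (c * x)) g := by
  unfold multiplesSum
  exact tsum_congr fun h => by rw [mul_left_comm]

/-- Sieving the sums along multiples. -/
theorem sum_primeWeight_mul_multiplesSum {a : ℝ} (ha : 1 < a) {P : Finset ℕ}
    (hP : ∀ p ∈ P, p.Prime) (W : ZMod N → ℝ) :
    ∑ g, primeWeight a P g * multiplesSum a W g =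
      ∑' h : ℕ, (h : ℝ) ^ (-a) * if ∀ p ∈ P, ¬ p ∣ h then ∑ b, W (h * b) else 0 := by
  classical
  induction P using Finset.induction_on generalizing W with
  | empty =>
    simp only [primeWeight, Finset.prod_empty, one_mul, Finset.notMem_empty, false_imp_iff,
      implies_true, if_true, Finset.mul_sum, multiplesSum]
    rw [Summable.tsum_finsetSum fun g _ => summable_multiplesSum ha W g]
  | insert p P hpP ih =>
    have hPP : ∀ q ∈ P, q.Prime := fun q hq => hP q (Finset.mem_insert_of_mem hq)
    have hp : p.Prime := hP p (Finset.mem_insert_self _ _)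
    -- The new factor subtracts the sum over multiples of `p`, counted with fibre sizes. By
    -- `sum_mul_left_eq` this is a full sum over `b` with `g = p * b`, where the old weight is
    -- unchanged and `W` becomes `W (p * ·)`.
    have key : ∑ g : ZMod N, primeWeight a (insert p P) g * multiplesSum a W g =
        ∑ g, primeWeight a P g * multiplesSum a W g -
          (p : ℝ) ^ (-a) * ∑ g : ZMod N, primeWeight a P g * multiplesSum a (fun x : ZMod N => W (p * x)) g := by
      have := sum_mul_left_eq (N := N) p fun g => primeWeight a P g * multiplesSum a W g
      simp only [primeWeight_mul_left hPP hp hpP, multiplesSum_mul_left] at this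
      rw [this, Finset.mul_sum, ← Finset.sum_sub_distrib]
      refine Finset.sum_congr rfl fun g _ => ?_
      have : primeWeight a (insert p P) g = (1 - (p : ℝ) ^ (-a) *
          if (p : ZMod N) ∣ g then (kerCard N p : ℝ) else 0) * primeWeight a P g := by
        unfold primeWeight
        rw [Finset.prod_insert hpP]
      rw [this]
      ring
    have hbd (h : ℕ) (Q : Prop) [Decidable Q] :
        |if Q then ∑ b : ZMod N, W ((h : ZMod N) * b) else 0| ≤ ∑ _b : ZMod N, (exists_abs_le W).choose := by
      have hB := (exists_abs_le W).choose_spec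
      have h1 : |∑ b : ZMod N, W ((h : ZMod N) * b)| ≤ ∑ _b : ZMod N, (exists_abs_le W).choose :=
        (Finset.abs_sum_le_sum_abs _ _).trans (Finset.sum_le_sum fun b _ => hB _)
      split_ifs
      · exact h1
      · simpa using (abs_nonneg _).trans h1
    -- Since `p ^ (-a) * h ^ (-a) = (p * h) ^ (-a)`, the subtracted series consists of exactly the
    -- terms whose index is divisible by `p`.
    have hmul : (p : ℝ) ^ (-a) * ∑' h : ℕ, (h : ℝ) ^ (-a) *
          (if ∀ q ∈ P, ¬ q ∣ h then ∑ b : ZMod N, W (p * (h * b)) else 0) =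
        ∑' h : ℕ, (h : ℝ) ^ (-a) *
          if p ∣ h ∧ ∀ q ∈ P, ¬ q ∣ h then ∑ b, W (h * b) else 0 := by
      rw [← tsum_mul_left, ← (mul_right_injective₀ hp.ne_zero).tsum_eq (f := fun h : ℕ =>
        (h : ℝ) ^ (-a) * if p ∣ h ∧ ∀ q ∈ P, ¬ q ∣ h then ∑ b, W (h * b) else 0)]
      · refine tsum_congr fun h => ?_
        have : (∀ q ∈ P, ¬ q ∣ p * h) ↔ ∀ q ∈ P, ¬ q ∣ h := by
          refine forall₂_congr fun q hq => ?_
          rw [(hPP q hq).dvd_mul, Nat.prime_dvd_prime_iff_eq (hPP q hq) hp]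
          have : q ≠ p := fun h => hpP (h ▸ hq)
          tauto
        simp only [this, dvd_mul_right, true_and, Nat.cast_mul, mul_assoc]
        rw [Real.mul_rpow (by positivity) (by positivity), mul_assoc]
      · intro h hh
        by_contra hn
        have : ¬ p ∣ h := fun ⟨k, hk⟩ => hn ⟨k, hk.symm⟩
        simp [this] at hh
    rw [key, ih hPP W, ih hPP, hmul, ← Summable.tsum_sub
      (summable_nat_rpow_mul ha fun h => hbd h _) (summable_nat_rpow_mul ha fun h => hbd h _)]
    refine tsum_congr fun h => ?_
    rw [← mul_sub]
    congr 1
    by_cases h1 : p ∣ h <;> by_cases h2 : ∀ q ∈ P, ¬ q ∣ h <;>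
      simp [h1, h2]

/-- After sieving by the primes dividing `N`, the surviving `h` are units of `ZMod N`; they permute
the residues, so each contributes the full sum of `W`. -/
theorem sum_primeWeight_primeFactors {a : ℝ} (ha : 1 < a) (W : ZMod N → ℝ) :
    ∑ g, primeWeight a N.primeFactors g * multiplesSum a W g =
      (∑' h : ℕ, (h : ℝ) ^ (-a) * if ∀ p ∈ N.primeFactors, ¬ p ∣ h then 1 else 0) * ∑ b, W b := by
  rw [sum_primeWeight_mul_multiplesSum ha fun p hp => Nat.prime_of_mem_primeFactors hp,
    ← tsum_mul_right]
  refine tsum_congr fun h => ?_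
  rw [mul_assoc, ite_mul, one_mul, zero_mul]
  split_ifs with hh
  · congr 1
    have hu : IsUnit (h : ZMod N) := by
      rw [ZMod.isUnit_iff_coprime]
      refine Nat.Coprime.symm (Nat.coprime_of_dvd fun p hp hpN hph => hh p ?_ hph)
      exact Nat.mem_primeFactors.mpr ⟨hp, hpN, NeZero.ne N⟩
    obtain ⟨u, hu⟩ := hu
    rw [← hu]
    exact Equiv.sum_comp (Units.mulLeft u) W
  · rfl

/-- With `Z` the series over `h` coprime to `N`, the weighted sum of `multiplesSum a W` is `Z * ∑
W`. The case `W = 1` evaluates the total weight: `(∑ v) * ζ = Z * N`. The term `g = 0` can be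
dropped from the first sum because it is nonnegative, while the remaining weight `V` still satisfies
`V * ζ ≥ (N - 1) * Z`. So the weighted mean over `g ≠ 0` is at most `ζ * ∑ W / (N - 1)`. -/
theorem exists_ne_zero_multiplesSum_le (hN : 2 ≤ N) {a : ℝ} (ha : 1 < a) {W : ZMod N → ℝ}
    (hW : ∀ c, 0 ≤ W c) :
    ∃ g : ZMod N, g ≠ 0 ∧
      ((N : ℝ) - 1) * multiplesSum a W g ≤ (∑' h : ℕ, (h : ℝ) ^ (-a)) * ∑ b, W b := by
  set Z := ∑' h : ℕ, (h : ℝ) ^ (-a) * if ∀ p ∈ N.primeFactors, ¬ p ∣ h then 1 else 0 with hZ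
  set v : ZMod N → ℝ := primeWeight a N.primeFactors
  have hpr : ∀ p ∈ N.primeFactors, p.Prime := fun p hp => Nat.prime_of_mem_primeFactors hp
  have h1 := sum_primeWeight_primeFactors (N := N) ha W
  have h2 := sum_primeWeight_primeFactors (N := N) ha fun _ => 1
  simp only [multiplesSum, mul_one, ← Finset.sum_mul, Finset.sum_const, Finset.card_univ,
    ZMod.card, nsmul_eq_mul] at h2
  change ∑ g, v g * multiplesSum a W g = Z * _ at h1
  change (∑ g, v g) * _ = Z * N at h2
  have hv0 : (N : ℝ) * v 0 ≤ ∑ g, v g := by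
    have := Finset.card_nsmul_le_sum Finset.univ v (v 0)
      fun g _ => primeWeight_zero_le ha hpr g
    simpa using this
  have hv : ∀ g, 0 ≤ v g := primeWeight_nonneg ha hpr
  have hZpos : 0 < Z := by
    have hs : Summable fun h : ℕ =>
        (h : ℝ) ^ (-a) * if ∀ p ∈ N.primeFactors, ¬ p ∣ h then (1 : ℝ) else 0 :=
      summable_nat_rpow_mul ha (B := 1) fun h => by split_ifs <;> simp
    refine hs.tsum_pos (fun h => by positivity) 1 ?_
    have : ∀ p ∈ N.primeFactors, ¬ p ∣ 1 := fun p hp h => (hpr p hp).one_lt.ne' (Nat.dvd_one.mp h)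
    rw [if_pos this]
    simp
  have hN0 : (2 : ℝ) ≤ N := by exact_mod_cast hN
  set ζ := ∑' h : ℕ, (h : ℝ) ^ (-a)
  have hζ : 0 ≤ ζ := tsum_nonneg fun h => by positivity
  have hζpos : 0 < ζ := by
    refine lt_of_le_of_ne hζ fun h => ?_
    rw [← h, mul_zero] at h2
    have : 0 < Z * N := by positivity
    linarith
  have hF0 : 0 ≤ multiplesSum a W 0 := tsum_nonneg fun h => mul_nonneg (by positivity) (hW _)
  by_contra! hcon
  have hsplit (f : ZMod N → ℝ) : ∑ g, f g = f 0 + ∑ g ∈ Finset.univ.erase 0, f g :=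
    (Finset.add_sum_erase _ _ (Finset.mem_univ _)).symm
  set V := ∑ g ∈ Finset.univ.erase (0 : ZMod N), v g
  have hVeq : ∑ g, v g = v 0 + V := hsplit v
  set A := ∑ b, W b
  have hA : 0 ≤ A := Finset.sum_nonneg fun b _ => hW b
  have hVpos : 0 < V := by
    have : 0 < ∑ g, v g := by
      have : 0 < (∑ g, v g) * ζ := by rw [h2]; positivity
      exact pos_of_mul_pos_left this hζ
    nlinarith
  have hlt : ζ * A * V < ((N : ℝ) - 1) * ∑ g ∈ Finset.univ.erase (0 : ZMod N),
      v g * multiplesSum a W g := by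
    rw [Finset.mul_sum _ _ (ζ * A), Finset.mul_sum _ _ ((N : ℝ) - 1)]
    obtain ⟨g₀, hg₀, hvg⟩ : ∃ g ∈ Finset.univ.erase (0 : ZMod N), 0 < v g :=
      Finset.exists_lt_of_sum_lt (f := fun _ => 0) (by rwa [Finset.sum_const_zero])
    refine Finset.sum_lt_sum (fun g hg => ?_) ⟨g₀, hg₀, ?_⟩
    · have := hcon g (Finset.ne_of_mem_erase hg)
      nlinarith [hv g]
    · have := hcon g₀ (Finset.ne_of_mem_erase hg₀)
      nlinarith
  have h3 : v 0 * multiplesSum a W 0 + ∑ g ∈ Finset.univ.erase (0 : ZMod N),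
      v g * multiplesSum a W g = Z * A := by rw [← h1, hsplit]
  have h4 : ∑ g ∈ Finset.univ.erase (0 : ZMod N), v g * multiplesSum a W g ≤ Z * A := by
    have := mul_nonneg (hv 0) hF0
    linarith
  have h5 : ζ * A * V < ((N : ℝ) - 1) * (Z * A) :=
    hlt.trans_le (mul_le_mul_of_nonneg_left h4 (by linarith))
  -- Because `v 0` is at most the mean weight, the nonzero residues carry at least the fraction `(N
  -- - 1) / N` of the total.
  have h6 : ((N : ℝ) - 1) * (∑ g, v g) ≤ N * V := by rw [hVeq] at hv0 ⊢; nlinarith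
  have h7 : ((N : ℝ) - 1) * (Z * N) ≤ N * V * ζ := by
    rw [← h2, ← mul_assoc]
    exact mul_le_mul_of_nonneg_right h6 hζ
  have h8 : ((N : ℝ) - 1) * Z ≤ V * ζ := by
    have : (N : ℝ) * (((N : ℝ) - 1) * Z) ≤ N * (V * ζ) := by linarith
    exact le_of_mul_le_mul_left this (by linarith)
  nlinarith

end Averaging

/-! ### Worst-case error as the norm of a representer -/

section WorstCaseError

open MeasureTheory InnerProductSpace

theorem iSup_ofReal_abs_inner {H : Type*} [NormedAddCommGroup H] [InnerProductSpace ℝ H] (h : H) :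
    ⨆ (f : H) (_ : ‖f‖ ≤ 1), ENNReal.ofReal |⟪f, h⟫_ℝ| = ENNReal.ofReal ‖h‖ := by
  refine le_antisymm (iSup₂_le fun f hf => ENNReal.ofReal_le_ofReal ?_) ?_
  · exact (abs_real_inner_le_norm f h).trans (mul_le_of_le_one_left (norm_nonneg h) hf)
  · rcases eq_or_ne h 0 with rfl | h0
    · simp
    · have h1 : ‖h‖ ≠ 0 := norm_ne_zero_iff.mpr h0
      refine le_iSup₂_of_le (‖h‖⁻¹ • h) (by rw [norm_smul, norm_inv, norm_norm, inv_mul_cancel₀ h1])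
        (ENNReal.ofReal_le_ofReal ?_)
      rw [real_inner_smul_left, real_inner_self_eq_norm_sq, pow_two, inv_mul_cancel_left₀ h1]
      exact le_abs_self _

theorem kerFun_ofKernel_inner {X : Type*} (K : X → X → ℝ) [Fact (kernelMatrix K).PosSemidef]
    (x y : X) :
    ⟪RKHS.kerFun (RKHS.OfKernel (kernelMatrix K)) x (1 : ℝ),
      RKHS.kerFun (RKHS.OfKernel (kernelMatrix K)) y (1 : ℝ)⟫_ℝ = K x y := by
  rw [RKHS.kerFun_inner, RKHS.kerFun_apply, RKHS.OfKernel.kernel_ofKernel]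
  simp [kernelMatrix]

theorem continuous_kerFun_ofKernel {X : Type*} [TopologicalSpace X] (K : X → X → ℝ)
    [Fact (kernelMatrix K).PosSemidef] (hc : Continuous fun p : X × X => K p.1 p.2) :
    Continuous fun x => RKHS.kerFun (RKHS.OfKernel (kernelMatrix K)) x (1 : ℝ) := by
  refine continuous_iff_continuousAt.mpr fun x => tendsto_iff_norm_sub_tendsto_zero.mpr ?_
  have h1 : ∀ y, ‖RKHS.kerFun (RKHS.OfKernel (kernelMatrix K)) y (1 : ℝ) -
      RKHS.kerFun (RKHS.OfKernel (kernelMatrix K)) x (1 : ℝ)‖ =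
        √(K y y - 2 * K y x + K x x) := fun y => by
    rw [← Real.sqrt_sq (norm_nonneg _), norm_sub_sq_real, ← real_inner_self_eq_norm_sq,
      ← real_inner_self_eq_norm_sq, kerFun_ofKernel_inner, kerFun_ofKernel_inner,
      kerFun_ofKernel_inner]
  simp only [h1]
  have hyy : Continuous fun y => K y y := hc.comp (continuous_id.prodMk continuous_id)
  have hyx : Continuous fun y => K y x := hc.comp (continuous_id.prodMk continuous_const)
  have : Continuous fun y => √(K y y - 2 * K y x + K x x) := by fun_prop
  refine (this.tendsto x).trans ?_
  ring_nf
  simp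

/-- The integration error is the inner product with `w = u - (1 / N) ∑ k (P n)`, where `u` is the
Bochner integral of the kernel sections. By `hint`, `⟪k x, u⟫ = 1` for all `x` and hence `‖u‖ = 1`;
expanding `‖w‖ ^ 2` gives the formula. -/
theorem worstCaseError_eq {s N : ℕ} (hN : 0 < N) {K : (Fin s → I) → (Fin s → I) → ℝ}
    (hK : IsPSDKernel K) (hc : Continuous fun p : (Fin s → I) × (Fin s → I) => K p.1 p.2)
    (hint : ∀ x, ∫ y, K x y = 1) (P : Fin N → Fin s → I) :
    0 ≤ (1 / (N : ℝ) ^ 2) * ∑ n, ∑ m, K (P n) (P m) - 1 ∧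
    worstCaseError K hK P =
      ENNReal.ofReal √((1 / (N : ℝ) ^ 2) * ∑ n, ∑ m, K (P n) (P m) - 1) := by
  have : Fact (kernelMatrix K).PosSemidef := ⟨hK.posSemidef⟩
  set H := RKHS.OfKernel (kernelMatrix K)
  set k : (Fin s → I) → H := fun x => RKHS.kerFun H x (1 : ℝ) with hk
  have hkc : Continuous k := continuous_kerFun_ofKernel K hc
  have hki : Integrable k := hkc.integrable_of_hasCompactSupport (HasCompactSupport.of_compactSpace k)
  have hkk : ∀ x y, ⟪k x, k y⟫_ℝ = K x y := kerFun_ofKernel_inner K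
  have heval : ∀ (f : H) x, f x = ⟪f, k x⟫_ℝ := fun f x => by
    rw [hk, RKHS.inner_kerFun]; simp
  set u : H := ∫ x, k x
  have hu : ∀ f : H, ∫ x, f x = ⟪f, u⟫_ℝ := fun f => by
    simp only [heval]
    exact integral_inner hki f
  have hku : ∀ x, ⟪k x, u⟫_ℝ = 1 := fun x => by
    rw [← integral_inner hki]
    simp only [hkk, hint]
  have huu : ⟪u, u⟫_ℝ = 1 := by
    rw [← integral_inner hki]
    simp only [real_inner_comm _ u, hku]
    simp
  set w : H := u - (1 / (N : ℝ)) • ∑ n, k (P n) with hw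
  have hN0 : (N : ℝ) ≠ 0 := by exact_mod_cast hN.ne'
  have hnorm : ‖w‖ ^ 2 = (1 / (N : ℝ) ^ 2) * ∑ n, ∑ m, K (P n) (P m) - 1 := by
    rw [hw, norm_sub_sq_real, ← real_inner_self_eq_norm_sq, ← real_inner_self_eq_norm_sq, huu,
      real_inner_smul_right, real_inner_smul_left, real_inner_smul_right, real_inner_comm, sum_inner]
    simp only [sum_inner, inner_sum, hkk, hku]
    rw [Finset.sum_comm (f := fun m n => K (P n) (P m))]
    simp
    field_simp
    ring
  refine ⟨hnorm ▸ sq_nonneg _, ?_⟩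
  rw [← hnorm, Real.sqrt_sq (norm_nonneg _), ← iSup_ofReal_abs_inner]
  unfold worstCaseError
  refine iSup_congr fun f => iSup_congr fun _ => ?_
  rw [hu, hw, inner_sub_right, real_inner_smul_right, inner_sum]
  simp only [heval]

end WorstCaseError

/-! ### Continuity and unit integrals of the two kernels -/

section Kernels

open MeasureTheory

theorem continuous_tsum_kernel {ι : Type*} {F : ι → I → I → ℝ} {b : ι → ℝ}
    (hF : ∀ i, Continuous fun p : I × I => F i p.1 p.2) (hb : Summable b)
    (hFb : ∀ i x y, |F i x y| ≤ b i) : Continuous fun p : I × I => ∑' i, F i p.1 p.2 :=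
  continuous_tsum hF hb fun i p => hFb i p.1 p.2

theorem integral_tsum_kernel {ι : Type*} [Countable ι] {F : ι → I → I → ℝ} {b : ι → ℝ}
    (hF : ∀ i, Continuous fun p : I × I => F i p.1 p.2) (hb : Summable b)
    (hFb : ∀ i x y, |F i x y| ≤ b i) (x : I) :
    ∫ y, ∑' i, F i x y = ∑' i, ∫ y, F i x y := by
  have hc : ∀ i, Continuous (F i x) := fun i => (hF i).comp (continuous_const.prodMk continuous_id)
  have hi : ∀ i, Integrable (F i x) := fun i =>
    (hc i).integrable_of_hasCompactSupport (HasCompactSupport.of_compactSpace _)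
  refine (integral_tsum_of_summable_integral_norm hi (hb.of_nonneg_of_le
    (fun i => integral_nonneg fun y => norm_nonneg _) fun i => ?_)).symm
  refine (integral_mono (hi i).norm (integrable_const (b i)) fun y => hFb i x y).trans ?_
  simp

theorem integral_cos_add_mul {b : ℝ} (hb : b ≠ 0) (a : ℝ) :
    ∫ y : I, Real.cos (a + b * y) = (Real.sin (a + b) - Real.sin a) / b := by
  rw [unitInterval.measurePreserving_coe.integral_comp unitInterval.measurableEmbedding_coe
    (fun t : ℝ => Real.cos (a + b * t)), integral_Icc_eq_integral_Ioc,
    ← intervalIntegral.integral_of_le zero_le_one, intervalIntegral.integral_comp_add_mul _ hb]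
  simp [integral_cos, div_eq_inv_mul]

variable {α γ : ℝ}

theorem abs_r_mul_le (hγ : 0 < γ) (h : ℤ) {t B : ℝ} (ht : |t| ≤ B) :
    |r α γ h * t| ≤ r α γ h * B := by
  rw [abs_mul, abs_of_nonneg (r_nonneg hγ h)]
  exact mul_le_mul_of_nonneg_left ht (r_nonneg hγ h)

theorem korKernel₁_eq_tsum (hα : 1 / 2 < α) (hγ : 0 < γ) (x y : I) :
    korKernel₁ α γ x y = ∑' h : ℤ, r α γ h * Real.cos (2 * Real.pi * h * ((x : ℝ) - y)) := by
  have key : ∀ h : ℤ, Complex.exp (2 * Real.pi * Complex.I * h * ((x : ℝ) - (y : ℝ))) =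
      Complex.exp (((2 * Real.pi * h * ((x : ℝ) - (y : ℝ)) : ℝ) : ℂ) * Complex.I) := by
    intro h
    congr 1
    push_cast
    ring
  have hs : Summable fun h : ℤ => (r α γ h : ℂ) *
      Complex.exp (2 * Real.pi * Complex.I * h * ((x : ℝ) - (y : ℝ))) := by
    refine Summable.of_norm_bounded (summable_r (γ := γ) hα) fun h => ?_
    rw [key, norm_mul, Complex.norm_exp_ofReal_mul_I, mul_one, Complex.norm_real,
      Real.norm_of_nonneg (r_nonneg hγ h)]
  unfold korKernel₁
  rw [Complex.re_tsum hs]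
  refine tsum_congr fun h => ?_
  rw [key, Complex.re_ofReal_mul, Complex.exp_ofReal_mul_I_re]

theorem continuous_korKernel₁ (hα : 1 / 2 < α) (hγ : 0 < γ) :
    Continuous fun p : I × I => korKernel₁ α γ p.1 p.2 := by
  simp only [korKernel₁_eq_tsum hα hγ]
  exact continuous_tsum_kernel
    (F := fun (h : ℤ) x y => r α γ h * Real.cos (2 * Real.pi * h * ((x : ℝ) - y)))
    (fun h => by fun_prop) ((summable_r (γ := γ) hα).mul_right 1)
    fun h x y => abs_r_mul_le hγ h (Real.abs_cos_le_one _)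

theorem integral_korKernel₁ (hα : 1 / 2 < α) (hγ : 0 < γ) (x : I) :
    ∫ y, korKernel₁ α γ x y = 1 := by
  simp only [korKernel₁_eq_tsum hα hγ]
  rw [integral_tsum_kernel
    (F := fun (h : ℤ) x y => r α γ h * Real.cos (2 * Real.pi * h * ((x : ℝ) - y)))
    (fun h => by fun_prop) ((summable_r (γ := γ) hα).mul_right 1)
    fun h x y => abs_r_mul_le hγ h (Real.abs_cos_le_one _), tsum_eq_single 0]
  · simp [r]
  · intro h hh
    have hb : -(2 * Real.pi * h) ≠ 0 := by
      have : (h : ℝ) ≠ 0 := by exact_mod_cast hh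
      simp [Real.pi_ne_zero, this]
    have := integral_cos_add_mul hb (2 * Real.pi * h * x)
    have hsin : Real.sin (2 * Real.pi * h * x + -(2 * Real.pi * h)) =
        Real.sin (2 * Real.pi * h * x) := by
      rw [← Real.sin_sub_int_mul_two_pi (2 * Real.pi * h * x) h]
      ring_nf
    rw [hsin, sub_self, zero_div] at this
    rw [integral_const_mul, ← mul_zero (r α γ h), ← this]
    congr 1
    refine integral_congr_ae (Filter.Eventually.of_forall fun y => ?_)
    simp only
    ring_nf

theorem summable_r_nat (hα : 1 / 2 < α) : Summable fun k : ℕ => r α γ ((k : ℤ) + 1) :=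
  (summable_r (γ := γ) hα).comp_injective (i := fun k : ℕ => (k : ℤ) + 1)
    fun a b h => by simpa using h

theorem abs_two_cos_mul_cos_le (a b : ℝ) : |2 * (Real.cos a * Real.cos b)| ≤ 2 := by
  rw [abs_mul, abs_mul, abs_two]
  have := mul_le_one₀ (Real.abs_cos_le_one a) (abs_nonneg _) (Real.abs_cos_le_one b)
  linarith

theorem cosKernel₁_eq_tsum (x y : I) :
    cosKernel₁ α γ x y = 1 + ∑' k : ℕ, r α γ ((k : ℤ) + 1) *
      (2 * (Real.cos (Real.pi * (k + 1) * x) * Real.cos (Real.pi * (k + 1) * y))) := by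
  unfold cosKernel₁
  congr 1
  refine tsum_congr fun k => ?_
  have h2 : √(2 : ℝ) * √2 = 2 := Real.mul_self_sqrt (by norm_num)
  linear_combination (r α γ ((k : ℤ) + 1) *
      (Real.cos (Real.pi * (k + 1) * x) * Real.cos (Real.pi * (k + 1) * y))) * h2

theorem continuous_cosKernel₁ (hα : 1 / 2 < α) (hγ : 0 < γ) :
    Continuous fun p : I × I => cosKernel₁ α γ p.1 p.2 := by
  simp only [cosKernel₁_eq_tsum]
  exact continuous_const.add (continuous_tsum_kernel
    (F := fun (k : ℕ) x y => r α γ ((k : ℤ) + 1) *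
      (2 * (Real.cos (Real.pi * (k + 1) * x) * Real.cos (Real.pi * (k + 1) * y))))
    (fun h => by fun_prop) ((summable_r_nat (γ := γ) hα).mul_right 2)
    fun h x y => abs_r_mul_le hγ _ (abs_two_cos_mul_cos_le _ _))

theorem integral_cosKernel₁ (hα : 1 / 2 < α) (hγ : 0 < γ) (x : I) :
    ∫ y, cosKernel₁ α γ x y = 1 := by
  set F := fun (k : ℕ) (x y : I) => r α γ ((k : ℤ) + 1) *
      (2 * (Real.cos (Real.pi * (k + 1) * x) * Real.cos (Real.pi * (k + 1) * y))) with hF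
  have hFc : ∀ k, Continuous fun p : I × I => F k p.1 p.2 := fun k => by fun_prop
  have hb := (summable_r_nat (γ := γ) hα).mul_right 2
  have hFb : ∀ k x y, |F k x y| ≤ r α γ ((k : ℤ) + 1) * 2 :=
    fun k x y => abs_r_mul_le hγ _ (abs_two_cos_mul_cos_le _ _)
  have hint : Integrable fun y => ∑' k, F k x y :=
    ((continuous_tsum_kernel hFc hb hFb).comp
      (continuous_const.prodMk continuous_id)).integrable_of_hasCompactSupport
        (HasCompactSupport.of_compactSpace _)
  have h0 : ∀ k, ∫ y, F k x y = 0 := fun k => by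
    have hb : Real.pi * ((k : ℝ) + 1) ≠ 0 := by positivity
    have := integral_cos_add_mul hb 0
    have hsin : Real.sin (Real.pi * ((k : ℝ) + 1)) = 0 := by
      have := Real.sin_nat_mul_pi (k + 1)
      rwa [Nat.cast_add_one, mul_comm] at this
    simp only [zero_add, hsin, Real.sin_zero, sub_self, zero_div] at this
    simp only [hF]
    rw [integral_const_mul, integral_const_mul, integral_const_mul, this]
    simp
  calc ∫ y, cosKernel₁ α γ x y = ∫ y, (1 + ∑' k, F k x y) := by simp only [cosKernel₁_eq_tsum, hF]
    _ = 1 := by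
      rw [integral_add (integrable_const _) hint, integral_tsum_kernel hFc hb hFb]
      simp [h0]

theorem continuous_prod_kernel {s : ℕ} {K : Fin s → I → I → ℝ}
    (hK : ∀ j, Continuous fun p : I × I => K j p.1 p.2) :
    Continuous fun p : (Fin s → I) × (Fin s → I) => ∏ j, K j (p.1 j) (p.2 j) :=
  continuous_finsetProd _ fun j _ => (hK j).comp (g := fun p : I × I => K j p.1 p.2)
    (f := fun p : (Fin s → I) × (Fin s → I) => (p.1 j, p.2 j)) (by fun_prop)

theorem integral_prod_kernel {s : ℕ} {K : Fin s → I → I → ℝ}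
    (hK : ∀ j x, ∫ y, K j x y = 1) (x : Fin s → I) : ∫ y : Fin s → I, ∏ j, K j (x j) (y j) = 1 := by
  rw [integral_fintype_prod_volume_eq_prod (fun j (t : I) => K j (x j) t)]
  simp [hK]

end Kernels

/-! ### Kernels at lattice nodes as finite Fourier sums on `ZMod N` -/

section Periodization

variable {α γ : ℝ}

/-- The total weight `∑ r(h)` of the frequencies `h ≡ c` modulo `N`. -/
def residueWeight (N : ℕ) (α γ : ℝ) (c : ZMod N) : ℝ :=
  ∑' h : ℤ, if (h : ZMod N) = c then r α γ h else 0

/-- The function `cos (2 π x / N)` on `ZMod N`. -/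
def charCos {N : ℕ} [NeZero N] (x : ZMod N) : ℝ := (ZMod.stdAddChar x).re

variable {N : ℕ} [NeZero N]

theorem charCos_intCast (j : ℤ) : charCos (j : ZMod N) = Real.cos (2 * Real.pi * j / N) := by
  unfold charCos
  rw [ZMod.stdAddChar_coe, ← Complex.exp_ofReal_mul_I_re]
  congr 2
  push_cast
  ring

theorem charCos_zero : charCos (0 : ZMod N) = 1 := by
  simp [charCos]

theorem charCos_neg (x : ZMod N) : charCos (-x) = charCos x := by
  have h1 := charCos_intCast (N := N) x.cast
  have h2 := charCos_intCast (N := N) (-x.cast)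
  rw [Int.cast_neg, ZMod.intCast_zmod_cast] at h2
  rw [ZMod.intCast_zmod_cast] at h1
  rw [h1, h2, ← Real.cos_neg]
  congr 1
  push_cast
  ring

theorem abs_charCos_le (x : ZMod N) : |charCos x| ≤ 1 := by
  have h1 := charCos_intCast (N := N) x.cast
  rw [ZMod.intCast_zmod_cast] at h1
  exact h1 ▸ Real.abs_cos_le_one _

theorem r_neg (h : ℤ) : r α γ (-h) = r α γ h := by
  simp [r]

omit [NeZero N] in
theorem summable_residueWeight (hα : 1 / 2 < α) (hγ : 0 < γ) (c : ZMod N) :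
    Summable fun h : ℤ => if (h : ZMod N) = c then r α γ h else 0 :=
  (summable_r (γ := γ) hα).of_nonneg_of_le
    (fun h => by split_ifs; exacts [r_nonneg hγ h, le_rfl])
    fun h => by split_ifs; exacts [le_rfl, r_nonneg hγ h]

omit [NeZero N] in
theorem residueWeight_nonneg (hγ : 0 < γ) (c : ZMod N) : 0 ≤ residueWeight N α γ c :=
  tsum_nonneg fun h => by split_ifs; exacts [r_nonneg hγ h, le_rfl]

omit [NeZero N] in
theorem residueWeight_neg (c : ZMod N) : residueWeight N α γ (-c) = residueWeight N α γ c := by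
  unfold residueWeight
  rw [← (Equiv.neg ℤ).tsum_eq]
  simp [r_neg]

theorem hasSum_r_mul (hα : 1 / 2 < α) (hγ : 0 < γ) (F : ZMod N → ℝ) :
    HasSum (fun h : ℤ => r α γ h * F h) (∑ c, residueWeight N α γ c * F c) := by
  have : HasSum (fun h : ℤ => ∑ c : ZMod N, (if (h : ZMod N) = c then r α γ h else 0) * F c)
      (∑ c, residueWeight N α γ c * F c) :=
    hasSum_sum fun c _ => (summable_residueWeight hα hγ c).hasSum.mul_right (F c)
  refine this.congr_fun fun h => ?_
  simp [ite_mul]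

/-- The imaginary parts cancel under `c ↦ -c`. -/
theorem sum_even_mul_charCos {F : ZMod N → ℝ} (hF : ∀ c, F (-c) = F c) (a : ZMod N) :
    ((∑ c, F c * charCos (c * a) : ℝ) : ℂ) = ∑ c, (F c : ℂ) * ZMod.stdAddChar (c * a) := by
  have him : ∀ x : ZMod N, (ZMod.stdAddChar (-x)).im = -(ZMod.stdAddChar x).im := fun x => by
    rw [AddChar.map_neg_eq_conj, Complex.conj_im]
  have hodd : ∑ c, F c * (ZMod.stdAddChar (c * a)).im = 0 := by
    have h1 : ∑ c, F c * (ZMod.stdAddChar (c * a)).im =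
        -∑ c, F c * (ZMod.stdAddChar (c * a)).im := by
      conv_lhs => rw [← Equiv.sum_comp (Equiv.neg (ZMod N))]
      simp [hF, him]
    linarith
  apply Complex.ext
  · simp [charCos]
  · simpa using hodd.symm

theorem korKernel₁_latticePoints (hα : 1 / 2 < α) (hγ : 0 < γ) {s : ℕ} (g : Fin s → ℕ)
    (n m : Fin N) (j : Fin s) :
    ((korKernel₁ α γ (latticePoints g N n j) (latticePoints g N m j) : ℝ) : ℂ) =
      ∑ c, ((residueWeight N α γ c : ℝ) : ℂ) * ZMod.stdAddChar (-(c * ((m : ℕ) : ZMod N) * (g j : ZMod N))) *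
        ZMod.stdAddChar (c * ((n : ℕ) : ZMod N) * (g j : ZMod N)) := by
  have hN : (N : ℝ) ≠ 0 := by exact_mod_cast NeZero.ne N
  have h1 : korKernel₁ α γ (latticePoints g N n j) (latticePoints g N m j) =
      ∑ c, residueWeight N α γ c * charCos (c * (((n : ℕ) : ZMod N) * (g j : ZMod N) - ((m : ℕ) : ZMod N) * (g j : ZMod N))) := by
    rw [korKernel₁_eq_tsum hα hγ,
      ← (hasSum_r_mul hα hγ fun c => charCos (c * (((n : ℕ) : ZMod N) * (g j : ZMod N) - ((m : ℕ) : ZMod N) * (g j : ZMod N)))).tsum_eq]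
    refine tsum_congr fun h => ?_
    have := charCos_intCast (N := N) (h * ((n : ℕ) * g j - (m : ℕ) * g j))
    push_cast at this
    rw [this]
    congr 1
    -- Taking fractional parts changes the two nodes by these floors, hence the argument by an
    -- integer multiple of `2 π`.
    rw [← Real.cos_sub_int_mul_two_pi _ (h * (⌊((m : ℕ) : ℝ) * g j / N⌋ - ⌊((n : ℕ) : ℝ) * g j / N⌋))]
    congr 1
    simp only [latticePoints, Int.fract]
    push_cast
    field_simp
    ring
  rw [h1, sum_even_mul_charCos residueWeight_neg]
  refine Finset.sum_congr rfl fun c _ => ?_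
  rw [mul_assoc, ← AddChar.map_add_eq_mul]
  congr 2
  ring

theorem cos_mul_tent (k : ℤ) (x : I) :
    Real.cos (Real.pi * k * (tent x : ℝ)) = Real.cos (2 * Real.pi * k * x) := by
  simp only [tent]
  rcases le_total 0 (2 * (x : ℝ) - 1) with h | h
  · rw [abs_of_nonneg h, ← Real.cos_neg, ← Real.cos_add_int_mul_two_pi _ k]
    congr 1
    ring
  · rw [abs_of_nonpos h]
    congr 1
    ring

/-- The tent map doubles the frequency inside the cosine, and the factor `√2 * √2 = 2` pairs `h`
with `-h`, giving a sum over all integers. -/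
theorem cosKernel₁_tent (hα : 1 / 2 < α) (hγ : 0 < γ) (x y : I) :
    cosKernel₁ α γ (tent x) (tent y) = ∑' h : ℤ, r α γ h *
      (Real.cos (2 * Real.pi * h * x) * Real.cos (2 * Real.pi * h * y)) := by
  obtain ⟨f, hf⟩ : ∃ f : ℤ → ℝ, ∀ h, f h = r α γ h *
      (Real.cos (2 * Real.pi * h * x) * Real.cos (2 * Real.pi * h * y)) := ⟨_, fun _ => rfl⟩
  have hs : Summable f := by
    refine Summable.of_norm_bounded ((summable_r (γ := γ) hα).mul_right 1) fun h => ?_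
    rw [hf]
    refine abs_r_mul_le hγ h ?_
    rw [abs_mul]
    exact mul_le_one₀ (Real.abs_cos_le_one _) (abs_nonneg _) (Real.abs_cos_le_one _)
  have hinj : Function.Injective fun k : ℕ => (k : ℤ) + 1 := fun a b h => by simpa using h
  have hneg : ∀ h, f (-h) = f h := fun h => by
    rw [hf, hf, r_neg, Int.cast_neg]
    simp only [mul_neg, neg_mul, Real.cos_neg]
  have h1 : Summable fun k : ℕ => f ((k : ℤ) + 1) := hs.comp_injective hinj
  have h2 : Summable fun k : ℕ => f (-((k : ℤ) + 1)) := by simpa only [hneg] using h1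
  have e1 : ∀ k : ℕ, r α γ ((k : ℤ) + 1) *
      (2 * (Real.cos (Real.pi * (k + 1) * tent x) * Real.cos (Real.pi * (k + 1) * tent y))) =
      2 * f ((k : ℤ) + 1) := fun k => by
    rw [hf, ← cos_mul_tent, ← cos_mul_tent]
    push_cast
    ring
  have e0 : f 0 = 1 := by simp [hf, r]
  rw [cosKernel₁_eq_tsum, ← tsum_congr hf, tsum_of_add_one_of_neg_add_one h1 h2]
  simp only [e1, hneg, tsum_mul_left, e0]
  ring

/-- Only the cosine in `n` is turned into a character, so that summing over `n` produces the dual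
lattice; the cosine in `m` remains as the damping factor. -/
theorem cosKernel₁_tentLatticePoints (hα : 1 / 2 < α) (hγ : 0 < γ) {s : ℕ} (g : Fin s → ℕ)
    (n m : Fin N) (j : Fin s) :
    ((cosKernel₁ α γ (tentLatticePoints g N n j) (tentLatticePoints g N m j) : ℝ) : ℂ) =
      ∑ c, ((residueWeight N α γ c : ℝ) : ℂ) * (charCos (c * ((m : ℕ) : ZMod N) * (g j : ZMod N)) : ℝ) *
        ZMod.stdAddChar (c * ((n : ℕ) : ZMod N) * (g j : ZMod N)) := by
  have hN : (N : ℝ) ≠ 0 := by exact_mod_cast NeZero.ne N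
  have h0 (n : Fin N) (h : ℤ) : Real.cos (2 * Real.pi * h * (latticePoints g N n j : ℝ)) =
      charCos ((h : ZMod N) * (((n : ℕ) : ZMod N) * (g j : ZMod N))) := by
    have := charCos_intCast (N := N) (h * ((n : ℕ) * g j))
    push_cast at this
    rw [this, ← Real.cos_add_int_mul_two_pi _ (h * ⌊((n : ℕ) : ℝ) * g j / N⌋)]
    congr 1
    simp only [latticePoints, Int.fract]
    push_cast
    field_simp
    ring
  have h1 : cosKernel₁ α γ (tentLatticePoints g N n j) (tentLatticePoints g N m j) =
      ∑ c, residueWeight N α γ c * charCos (c * (((m : ℕ) : ZMod N) * (g j : ZMod N))) *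
        charCos (c * (((n : ℕ) : ZMod N) * (g j : ZMod N))) := by
    have := (hasSum_r_mul hα hγ fun c => charCos (c * (((n : ℕ) : ZMod N) * (g j : ZMod N))) *
      charCos (c * (((m : ℕ) : ZMod N) * (g j : ZMod N)))).tsum_eq
    simp only [tentLatticePoints]
    rw [cosKernel₁_tent hα hγ]
    simp only [h0]
    rw [this]
    exact Finset.sum_congr rfl fun c _ => by ring
  rw [h1, sum_even_mul_charCos (F := fun c => residueWeight N α γ c * charCos (c * (((m : ℕ) : ZMod N) * (g j : ZMod N))))
    fun c => by rw [residueWeight_neg, neg_mul, charCos_neg]]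
  refine Finset.sum_congr rfl fun c _ => ?_
  rw [mul_assoc c, mul_assoc c, Complex.ofReal_mul]

end Periodization

/-! ### Dual-lattice sums and their growth by one coordinate -/

section GridSum

variable {N : ℕ} [NeZero N]

/-- A sum over the dual lattice of `z` modulo `N`, damped by the averages over `m` of the values of
`φ`; up to the constant `1` the squared worst-case errors are of this form. -/
def gridSum {d : ℕ} (φ : ZMod N → ℝ) (ρ : Fin d → ZMod N → ℝ) (z : Fin d → ZMod N) : ℝ :=
  (1 / (N : ℝ)) * ∑ m : ZMod N, ∑ c : Fin d → ZMod N,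
    if ∑ j, c j * z j = 0 then ∏ j, ρ j (c j) * φ (c j * m * z j) else 0

/-- The total weight of the frequencies `c` with `c ⬝ z = x`. -/
def dualWeight {d : ℕ} (ρ : Fin d → ZMod N → ℝ) (z : Fin d → ZMod N) (x : ZMod N) : ℝ :=
  ∑ c : Fin d → ZMod N, if ∑ j, c j * z j = x then ∏ j, ρ j (c j) else 0

theorem sum_fin_eq_sum_zmod {E : Type*} [AddCommMonoid E] (f : ZMod N → E) :
    ∑ n : Fin N, f ((n : ℕ) : ZMod N) = ∑ n, f n := by
  refine Fintype.sum_bijective (fun n : Fin N => ((n : ℕ) : ZMod N)) ?_ _ _ fun _ => rfl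
  rw [Fintype.bijective_iff_injective_and_card]
  refine ⟨fun a b h => Fin.ext ?_, by simp [ZMod.card]⟩
  have := (ZMod.natCast_eq_natCast_iff' _ _ _).mp h
  rwa [Nat.mod_eq_of_lt a.2, Nat.mod_eq_of_lt b.2] at this

theorem addChar_map_sum {A M ι : Type*} [AddCommMonoid A] [CommMonoid M] (ψ : AddChar A M)
    (t : Finset ι) (f : ι → A) : ψ (∑ i ∈ t, f i) = ∏ i ∈ t, ψ (f i) := by
  classical
  induction t using Finset.induction_on with
  | empty => simp
  | insert i t hi ih => rw [Finset.sum_insert hi, Finset.prod_insert hi, ψ.map_add_eq_mul, ih]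

/-- Expanding the product and summing over `n` first, orthogonality of characters leaves only the
`c` with `c ⬝ z = 0`. -/
theorem sum_prod_character {d : ℕ} (ρ : Fin d → ZMod N → ℂ) (ψ : ZMod N → ℂ)
    (z : Fin d → ZMod N) :
    ∑ n : ZMod N, ∑ m : ZMod N, ∏ j, ∑ c, ρ j c * ψ (c * m * z j) *
        ZMod.stdAddChar (c * n * z j) =
      N * ∑ m : ZMod N, ∑ c : Fin d → ZMod N,
        if ∑ j, c j * z j = 0 then ∏ j, ρ j (c j) * ψ (c j * m * z j) else 0 := by
  have hsum : ∀ x : ZMod N, ∑ n : ZMod N, (ZMod.stdAddChar (n * x) : ℂ) =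
      if x = 0 then (N : ℂ) else 0 := fun x => by
    have := AddChar.sum_mulShift x (ZMod.isPrimitive_stdAddChar N)
    simpa [ZMod.card] using this
  have hprod : ∀ (n : ZMod N) (c : Fin d → ZMod N), ∏ j, (ZMod.stdAddChar (c j * n * z j) : ℂ) =
      ZMod.stdAddChar (n * ∑ j, c j * z j) := fun n c => by
    rw [Finset.mul_sum, addChar_map_sum]
    exact Finset.prod_congr rfl fun j _ => by congr 1; ring
  simp only [Finset.prod_univ_sum, Fintype.piFinset_univ]
  rw [Finset.sum_comm, Finset.mul_sum]
  refine Finset.sum_congr rfl fun m _ => ?_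
  rw [Finset.sum_comm, Finset.mul_sum]
  refine Finset.sum_congr rfl fun c _ => ?_
  simp only [Finset.prod_mul_distrib, hprod, ← Finset.mul_sum, hsum]
  split_ifs <;> ring

/-- The factors `ψ` and `φ` need to agree only in product and only on the dual lattice. This lets
the Korobov case take `ψ x = stdAddChar (-x)` with `φ = 1`. -/
theorem average_eq_gridSum {d : ℕ} {κ : Fin N → Fin N → ℝ} (ρ : Fin d → ZMod N → ℝ)
    {ψ : ZMod N → ℂ}
    {φ : ZMod N → ℝ} (z : Fin d → ZMod N)
    (hκ : ∀ n m, (κ n m : ℂ) = ∏ j, ∑ c, (ρ j c : ℂ) * ψ (c * ((m : ℕ) : ZMod N) * z j) *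
      ZMod.stdAddChar (c * ((n : ℕ) : ZMod N) * z j))
    (hψ : ∀ (m : ZMod N) (c : Fin d → ZMod N), ∑ j, c j * z j = 0 →
      ∏ j, ψ (c j * m * z j) = ∏ j, (φ (c j * m * z j) : ℂ)) :
    (1 / (N : ℝ) ^ 2) * ∑ n, ∑ m, κ n m = gridSum φ ρ z := by
  have hN : (N : ℂ) ≠ 0 := by exact_mod_cast NeZero.ne N
  apply Complex.ofReal_injective
  have h1 : ((∑ n, ∑ m, κ n m : ℝ) : ℂ) = ∑ n : ZMod N, ∑ m : ZMod N, ∏ j, ∑ c, (ρ j c : ℂ) *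
      ψ (c * m * z j) * ZMod.stdAddChar (c * n * z j) := by
    push_cast
    simp only [hκ]
    rw [← sum_fin_eq_sum_zmod]
    refine Finset.sum_congr rfl fun n _ => ?_
    rw [← sum_fin_eq_sum_zmod]
  unfold gridSum
  rw [Complex.ofReal_mul, h1, sum_prod_character]
  push_cast
  have h2 : ∀ (m : ZMod N) (c : Fin d → ZMod N),
      (if ∑ j, c j * z j = 0 then ∏ j, (ρ j (c j) : ℂ) * ψ (c j * m * z j) else 0) =
      ((if ∑ j, c j * z j = 0 then ∏ j, ρ j (c j) * φ (c j * m * z j) else 0 : ℝ) : ℂ) := by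
    intro m c
    split_ifs with h
    · push_cast
      rw [Finset.prod_mul_distrib, Finset.prod_mul_distrib, hψ m c h]
    · simp
  simp only [h2]
  field_simp

theorem gridSum_le_gridSum_one {d : ℕ} {φ : ZMod N → ℝ} (hφ : ∀ x, |φ x| ≤ 1)
    {ρ : Fin d → ZMod N → ℝ} (hρ : ∀ j c, 0 ≤ ρ j c) (z : Fin d → ZMod N) :
    gridSum φ ρ z ≤ gridSum (fun _ => 1) ρ z := by
  refine mul_le_mul_of_nonneg_left (Finset.sum_le_sum fun m _ => Finset.sum_le_sum fun c _ => ?_)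
    (by positivity)
  split_ifs
  · refine (le_abs_self _).trans ?_
    rw [Finset.abs_prod]
    refine Finset.prod_le_prod (fun j _ => abs_nonneg _) fun j _ => ?_
    rw [abs_mul, abs_of_nonneg (hρ _ _)]
    exact mul_le_mul_of_nonneg_left (hφ _) (hρ _ _)
  · exact le_rfl

theorem gridSum_fin_zero {φ : ZMod N → ℝ} (ρ : Fin 0 → ZMod N → ℝ) (z : Fin 0 → ZMod N) :
    gridSum φ ρ z = 1 := by
  have hN : (N : ℝ) ≠ 0 := by exact_mod_cast NeZero.ne N
  simp [gridSum, ZMod.card, hN]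

theorem sum_fin_succ_fun {d : ℕ} {E : Type*} [AddCommMonoid E] (f : (Fin (d + 1) → ZMod N) → E) :
    ∑ c, f c = ∑ b, ∑ c : Fin d → ZMod N, f (Fin.snoc (α := fun _ => ZMod N) c b) := by
  rw [← (Fin.snocEquiv fun _ : Fin (d + 1) => ZMod N).sum_comp, Fintype.sum_prod_type]
  rfl

/-- The last weight splits into `θ` and a unit mass at 0. Since `φ 0 = 1`, the unit mass reproduces
the sum in dimension `d` exactly; the `θ` part is bounded by `|φ| ≤ 1`, uniformly in `m`. -/
theorem gridSum_succ_le {d : ℕ} {φ : ZMod N → ℝ} (hφ : ∀ x, |φ x| ≤ 1) (hφ0 : φ 0 = 1)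
    {ρ : Fin (d + 1) → ZMod N → ℝ} (hρ : ∀ j c, 0 ≤ ρ j c) {θ : ZMod N → ℝ} (hθ : ∀ c, 0 ≤ θ c)
    (hρθ : ∀ c, ρ (Fin.last d) c = θ c + if c = 0 then 1 else 0) (z : Fin d → ZMod N)
    (g : ZMod N) :
    gridSum φ ρ (Fin.snoc (α := fun _ => ZMod N) z g) ≤
      gridSum φ (fun j => ρ j.castSucc) z +
        ∑ b, θ b * dualWeight (fun j => ρ j.castSucc) z (-(b * g)) := by
  have hN : (0 : ℝ) < N := by exact_mod_cast NeZero.pos N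
  set D := ∑ b, θ b * dualWeight (fun j => ρ j.castSucc) z (-(b * g)) with hD
  suffices h : ∀ m : ZMod N, (∑ c : Fin (d + 1) → ZMod N,
      if ∑ j, c j * (Fin.snoc (α := fun _ => ZMod N) z g : Fin (d + 1) → ZMod N) j = 0 then
        ∏ j, ρ j (c j) * φ (c j * m * (Fin.snoc (α := fun _ => ZMod N) z g : Fin (d + 1) → ZMod N) j)
      else 0) ≤ (∑ c : Fin d → ZMod N, if ∑ j, c j * z j = 0 then
        ∏ j : Fin d, ρ j.castSucc (c j) * φ (c j * m * z j) else 0) + D by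
    unfold gridSum
    refine (mul_le_mul_of_nonneg_left (Finset.sum_le_sum fun m _ => h m) (by positivity)).trans ?_
    rw [Finset.sum_add_distrib, mul_add]
    simp [ZMod.card, hN.ne']
  intro m
  rw [sum_fin_succ_fun]
  simp only [Fin.sum_univ_castSucc, Fin.prod_univ_castSucc, Fin.snoc_castSucc, Fin.snoc_last, hρθ]
  have h1 : ∀ b : ZMod N, (∑ c : Fin d → ZMod N, if ∑ j, c j * z j + b * g = 0 then
        (∏ j : Fin d, ρ j.castSucc (c j) * φ (c j * m * z j)) *
          ((θ b + if b = 0 then 1 else 0) * φ (b * m * g)) else 0) ≤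
      θ b * dualWeight (fun j => ρ j.castSucc) z (-(b * g)) +
      if b = 0 then (∑ c : Fin d → ZMod N, if ∑ j, c j * z j = 0 then
        ∏ j : Fin d, ρ j.castSucc (c j) * φ (c j * m * z j) else 0) else 0 := by
    intro b
    have hle : ∀ c : Fin d → ZMod N, (∏ j : Fin d, ρ j.castSucc (c j) * φ (c j * m * z j)) *
        (θ b * φ (b * m * g)) ≤ θ b * ∏ j : Fin d, ρ j.castSucc (c j) := fun c => by
      refine (le_abs_self _).trans ?_
      rw [abs_mul, Finset.abs_prod, mul_comm]
      refine mul_le_mul ?_ ?_ (Finset.prod_nonneg fun _ _ => abs_nonneg _) (hθ b)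
      · rw [abs_mul, abs_of_nonneg (hθ b)]
        exact mul_le_of_le_one_right (hθ b) (hφ _)
      · refine Finset.prod_le_prod (fun j _ => abs_nonneg _) fun j _ => ?_
        rw [abs_mul, abs_of_nonneg (hρ _ _)]
        exact mul_le_of_le_one_right (hρ _ _) (hφ _)
    have hW : θ b * dualWeight (fun j => ρ j.castSucc) z (-(b * g)) =
        ∑ c : Fin d → ZMod N, if ∑ j, c j * z j + b * g = 0 then
          θ b * ∏ j : Fin d, ρ j.castSucc (c j) else 0 := by
      unfold dualWeight
      rw [Finset.mul_sum]
      refine Finset.sum_congr rfl fun c _ => ?_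
      simp only [mul_ite, mul_zero, ← eq_neg_iff_add_eq_zero]
    rw [hW]
    rcases eq_or_ne b 0 with rfl | hb
    · simp only [if_true]
      rw [← Finset.sum_add_distrib]
      refine Finset.sum_le_sum fun c _ => ?_
      have hc := hle c
      simp only [zero_mul, hφ0, mul_one, add_zero] at hc ⊢
      split_ifs
      · rw [mul_add, mul_one]
        linarith
      · simp
    · simp only [if_neg hb, add_zero]
      refine Finset.sum_le_sum fun c _ => ?_
      split_ifs
      · exact hle c
      · exact le_rfl
  refine (Finset.sum_le_sum fun b _ => h1 b).trans (le_of_eq ?_)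
  rw [Finset.sum_add_distrib, ← hD, add_comm]
  simp

theorem sum_dualWeight {d : ℕ} (ρ : Fin d → ZMod N → ℝ) (z : Fin d → ZMod N) :
    ∑ x, dualWeight ρ z x = ∏ j, ∑ c, ρ j c := by
  unfold dualWeight
  rw [Finset.sum_comm, Finset.prod_univ_sum, Fintype.piFinset_univ]
  simp

theorem dualWeight_nonneg {d : ℕ} {ρ : Fin d → ZMod N → ℝ} (hρ : ∀ j c, 0 ≤ ρ j c)
    (z : Fin d → ZMod N) (x : ZMod N) : 0 ≤ dualWeight ρ z x :=
  Finset.sum_nonneg fun c _ => by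
    split_ifs
    exacts [Finset.prod_nonneg fun j _ => hρ j _, le_rfl]

theorem rpow_sum_le_sum_rpow {ι : Type*} (t : Finset ι) {f : ι → ℝ} (hf : ∀ i, 0 ≤ f i) {p : ℝ}
    (hp : 0 < p) (hp1 : p ≤ 1) : (∑ i ∈ t, f i) ^ p ≤ ∑ i ∈ t, f i ^ p := by
  classical
  induction t using Finset.induction_on with
  | empty => simp [Real.zero_rpow hp.ne']
  | insert i t hi ih =>
    rw [Finset.sum_insert hi, Finset.sum_insert hi]
    exact (Real.rpow_add_le_add_rpow (hf i) (Finset.sum_nonneg fun j _ => hf j) hp.le hp1).trans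
      (by linarith)

theorem rpow_tsum_le_tsum_rpow {ι : Type*} {f : ι → ℝ} (hf : ∀ i, 0 ≤ f i) {p : ℝ}
    (hp : 0 < p) (hp1 : p ≤ 1) (hs : Summable f) (hsp : Summable fun i => f i ^ p) :
    (∑' i, f i) ^ p ≤ ∑' i, f i ^ p :=
  le_of_tendsto_of_tendsto' (hs.hasSum.rpow_const (Or.inr hp.le)) hsp.hasSum
    fun t => rpow_sum_le_sum_rpow t hf hp hp1

/-- Subadditivity of `t ↦ t ^ p` over `c`, then multiplicativity over the coordinates. -/
theorem dualWeight_rpow_le {d : ℕ} {ρ ρ' : Fin d → ZMod N → ℝ} (hρ : ∀ j c, 0 ≤ ρ j c) {p : ℝ}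
    (hp : 0 < p) (hp1 : p ≤ 1) (h : ∀ j c, ρ j c ^ p ≤ ρ' j c) (z : Fin d → ZMod N) (x : ZMod N) :
    dualWeight ρ z x ^ p ≤ dualWeight ρ' z x := by
  refine (rpow_sum_le_sum_rpow _ (fun c => ?_) hp hp1).trans (Finset.sum_le_sum fun c _ => ?_)
  · split_ifs
    exacts [Finset.prod_nonneg fun j _ => hρ j _, le_rfl]
  · split_ifs
    · rw [← Real.finsetProd_rpow _ _ fun j _ => hρ j _]
      exact Finset.prod_le_prod (fun j _ => Real.rpow_nonneg (hρ j _) p) fun j _ => h j _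
    · rw [Real.zero_rpow hp.ne']

end GridSum

/-! ### Both worst-case errors as dual-lattice sums -/

section ErrorFormulas

variable {N : ℕ} [NeZero N] {s : ℕ} {α : ℝ} {γ : Fin s → ℝ}

theorem korError_eq (hα : 1 / 2 < α) (hγ : ∀ j, 0 < γ j) (g : Fin s → ℕ) :
    0 ≤ gridSum (fun _ => 1) (fun j => residueWeight N α (γ j)) (fun j => (g j : ZMod N)) - 1 ∧
    korError N hα hγ g = ENNReal.ofReal √(gridSum (fun _ => 1)
      (fun j => residueWeight N α (γ j)) (fun j => (g j : ZMod N)) - 1) := by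
  have h := worstCaseError_eq (NeZero.pos N) (isPSDKernel_korKernel hα hγ)
    (continuous_prod_kernel fun j => continuous_korKernel₁ hα (hγ j))
    (integral_prod_kernel fun j => integral_korKernel₁ hα (hγ j)) (latticePoints g N)
  rwa [average_eq_gridSum (φ := fun _ => 1) (ψ := fun x => ZMod.stdAddChar (-x))
    (fun j => residueWeight N α (γ j)) (fun j => (g j : ZMod N))] at h
  · intro n m
    unfold korKernel
    rw [Complex.ofReal_prod]
    exact Finset.prod_congr rfl fun j _ => korKernel₁_latticePoints hα (hγ j) g n m j
  · intro m c hc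
    rw [← addChar_map_sum]
    have : ∑ j, -(c j * m * (g j : ZMod N)) = -(m * ∑ j, c j * (g j : ZMod N)) := by
      rw [Finset.mul_sum, ← Finset.sum_neg_distrib]
      exact Finset.sum_congr rfl fun j _ => by ring
    simp [this, hc]

theorem cosError_eq (hα : 1 / 2 < α) (hγ : ∀ j, 0 < γ j) (g : Fin s → ℕ) :
    0 ≤ gridSum charCos (fun j => residueWeight N α (γ j)) (fun j => (g j : ZMod N)) - 1 ∧
    cosError N hα hγ g = ENNReal.ofReal √(gridSum charCos
      (fun j => residueWeight N α (γ j)) (fun j => (g j : ZMod N)) - 1) := by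
  have h := worstCaseError_eq (NeZero.pos N) (isPSDKernel_cosKernel hα hγ)
    (continuous_prod_kernel fun j => continuous_cosKernel₁ hα (hγ j))
    (integral_prod_kernel fun j => integral_cosKernel₁ hα (hγ j)) (tentLatticePoints g N)
  rwa [average_eq_gridSum (φ := charCos) (ψ := fun x => (charCos x : ℝ))
    (fun j => residueWeight N α (γ j)) (fun j => (g j : ZMod N)) ?_ fun _ _ _ => rfl] at h
  intro n m
  unfold cosKernel
  rw [Complex.ofReal_prod]
  exact Finset.prod_congr rfl fun j _ => cosKernel₁_tentLatticePoints hα (hγ j) g n m j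

end ErrorFormulas

/-! ### Contribution of a new coordinate -/

section ExcessWeight

variable {N : ℕ} [NeZero N] {α γ : ℝ}

/-- The total weight of the nonzero frequencies `h ≡ c` modulo `N`. -/
def excessWeight (N : ℕ) (α γ : ℝ) (c : ZMod N) : ℝ :=
  ∑' h : ℤ, if (h : ZMod N) = c ∧ h ≠ 0 then r α γ h else 0

omit [NeZero N] in
theorem summable_ite_r (hα : 1 / 2 < α) (hγ : 0 < γ) (Q : ℤ → Prop) [DecidablePred Q] :
    Summable fun h : ℤ => if Q h then r α γ h else 0 :=
  (summable_r (γ := γ) hα).of_nonneg_of_le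
    (fun h => by split_ifs; exacts [r_nonneg hγ h, le_rfl])
    fun h => by split_ifs; exacts [le_rfl, r_nonneg hγ h]

omit [NeZero N] in
theorem excessWeight_nonneg (hγ : 0 < γ) (c : ZMod N) : 0 ≤ excessWeight N α γ c :=
  tsum_nonneg fun h => by split_ifs; exacts [r_nonneg hγ h, le_rfl]

omit [NeZero N] in
theorem residueWeight_eq (hα : 1 / 2 < α) (hγ : 0 < γ) (c : ZMod N) :
    residueWeight N α γ c = excessWeight N α γ c + if c = 0 then 1 else 0 := by
  unfold residueWeight excessWeight
  rw [(summable_ite_r hα hγ _).tsum_eq_add_tsum_ite 0, add_comm]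
  congr 1
  · exact tsum_congr fun h => by by_cases h0 : h = 0 <;> simp [h0]
  · simp [r, eq_comm]

theorem r_rpow (hγ : 0 < γ) (p : ℝ) (h : ℤ) : r α γ h ^ p = r (α * p) (γ ^ p) h := by
  unfold r
  split_ifs with h0
  · exact Real.one_rpow p
  · rw [Real.mul_rpow hγ.le (by positivity), ← Real.rpow_mul (abs_nonneg _)]
    ring_nf

/-- The family `r` is stable under powers, `(α, γ)` becoming `(α p, γ ^ p)`; `1 / 2 < α * p` is what
keeps the new series summable. -/
theorem tsum_ite_r_rpow_le {p : ℝ} (hp1 : p ≤ 1) (hαp : 1 / 2 < α * p) (hα : 1 / 2 < α)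
    (hγ : 0 < γ) (Q : ℤ → Prop) [DecidablePred Q] :
    (∑' h : ℤ, if Q h then r α γ h else 0) ^ p ≤
      ∑' h : ℤ, if Q h then r (α * p) (γ ^ p) h else 0 := by
  have hp : 0 < p := pos_of_mul_pos_right (by linarith : 0 < α * p) (by linarith)
  have e : ∀ h : ℤ, (if Q h then r α γ h else 0) ^ p =
      if Q h then r (α * p) (γ ^ p) h else 0 := fun h => by
    split_ifs
    exacts [r_rpow hγ p h, Real.zero_rpow hp.ne']
  have hs := summable_ite_r hαp (Real.rpow_pos_of_pos hγ p) Q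
  refine (rpow_tsum_le_tsum_rpow (fun h => ?_) hp hp1 (summable_ite_r hα hγ Q) ?_).trans
    (le_of_eq (tsum_congr e))
  · split_ifs; exacts [r_nonneg hγ h, le_rfl]
  · simpa only [e] using hs

theorem sum_excessWeight_mul (hα : 1 / 2 < α) (hγ : 0 < γ) (F : ZMod N → ℝ) :
    ∑ c, excessWeight N α γ c * F c = γ * multiplesSum (2 * α) (fun x => F x + F (-x)) 1 := by
  have h1 : HasSum (fun h : ℤ => ∑ c : ZMod N,
      (if (h : ZMod N) = c ∧ h ≠ 0 then r α γ h else 0) * F c) (∑ c, excessWeight N α γ c * F c) :=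
    hasSum_sum fun c _ => (summable_ite_r hα hγ _).hasSum.mul_right (F c)
  obtain ⟨f, hf⟩ : ∃ f : ℤ → ℝ, ∀ h, f h = (if h ≠ 0 then r α γ h else 0) * F h :=
    ⟨_, fun _ => rfl⟩
  have h2 : HasSum f (∑ c, excessWeight N α γ c * F c) := by
    refine h1.congr_fun fun h => ?_
    rw [hf]
    by_cases h0 : h = 0 <;> simp [h0, ite_mul]
  have i1 : Function.Injective fun k : ℕ => (k : ℤ) + 1 := fun a b h => by simpa using h
  have i2 : Function.Injective fun k : ℕ => -((k : ℤ) + 1) := fun a b h => by simpa using h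
  have s1 : Summable fun k : ℕ => f ((k : ℤ) + 1) := h2.summable.comp_injective i1
  have s2 : Summable fun k : ℕ => f (-((k : ℤ) + 1)) := h2.summable.comp_injective i2
  have f0 : f 0 = 0 := by simp [hf]
  rw [← h2.tsum_eq, tsum_of_add_one_of_neg_add_one s1 s2, f0, add_zero, ← s1.tsum_add s2]
  unfold multiplesSum
  have hsum := summable_multiplesSum (by linarith : 1 < 2 * α) (fun x => F x + F (-x)) 1
  rw [hsum.tsum_eq_zero_add]
  -- The index 0 contributes nothing to `multiplesSum`, since `0 ^ (-a) = 0` for `a ≠ 0` by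
  -- convention.
  have hz : ((0 : ℕ) : ℝ) ^ (-(2 * α)) = 0 := by
    rw [Nat.cast_zero, Real.zero_rpow (by linarith)]
  rw [hz, zero_mul, zero_add, ← tsum_mul_left]
  refine tsum_congr fun k => ?_
  have hk : (k : ℤ) + 1 ≠ 0 := by omega
  have hr : r α γ ((k : ℤ) + 1) = γ * ((k : ℝ) + 1) ^ (-(2 * α)) := by
    have : |((k : ℝ) + 1)| = (k : ℝ) + 1 := abs_of_nonneg (by positivity)
    simp [r, hk, this]
  rw [hf, hf, if_pos hk, if_pos (neg_ne_zero.mpr hk), r_neg, hr]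
  push_cast
  rw [mul_one]
  ring

theorem zetaReal_eq_tsum {a : ℝ} (ha : 1 < a) : zetaReal a = ∑' h : ℕ, (h : ℝ) ^ (-a) := by
  unfold zetaReal
  rw [zeta_eq_tsum_one_div_nat_cpow (by simpa using ha)]
  have : ∀ h : ℕ, 1 / (h : ℂ) ^ (a : ℂ) = (((h : ℝ) ^ (-a) : ℝ) : ℂ) := fun h => by
    rw [Real.rpow_neg (by positivity), Complex.ofReal_inv, Complex.ofReal_cpow (by positivity),
      one_div, Complex.ofReal_natCast]
  simp only [this, ← Complex.ofReal_tsum, Complex.ofReal_re]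

theorem zetaReal_pos {a : ℝ} (ha : 1 < a) : 0 < zetaReal a := by
  rw [zetaReal_eq_tsum ha]
  exact (Real.summable_nat_rpow.mpr (by linarith)).tsum_pos (fun h => by positivity) 1 (by simp)

theorem sum_residueWeight (hα : 1 / 2 < α) (hγ : 0 < γ) :
    ∑ c, residueWeight N α γ c = 1 + 2 * zetaReal (2 * α) * γ := by
  have h := sum_excessWeight_mul (N := N) hα hγ fun _ => 1
  simp only [mul_one, multiplesSum, tsum_mul_right] at h
  rw [← zetaReal_eq_tsum (by linarith)] at h
  simp only [residueWeight_eq hα hγ, Finset.sum_add_distrib, h]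
  simp
  ring

/-- Some nonzero residue makes the contribution of a new coordinate at most average. -/
theorem exists_sum_excessWeight_le (hN : 2 ≤ N) (hα : 1 / 2 < α) (hγ : 0 < γ) {W : ZMod N → ℝ}
    (hW : ∀ c, 0 ≤ W c) :
    ∃ g : ZMod N, g ≠ 0 ∧ ((N : ℝ) - 1) * ∑ b, excessWeight N α γ b * W (-(b * g)) ≤
      2 * zetaReal (2 * α) * γ * ∑ x, W x := by
  obtain ⟨g, hg, h⟩ := exists_ne_zero_multiplesSum_le hN (by linarith : 1 < 2 * α)
    (W := fun x => W (-x) + W x) fun c => add_nonneg (hW _) (hW _)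
  refine ⟨g, hg, ?_⟩
  rw [sum_excessWeight_mul hα hγ fun b => W (-(b * g))]
  have h1 : multiplesSum (2 * α) (fun x => W (-(x * g)) + W (-(-x * g))) (1 : ZMod N) =
      multiplesSum (2 * α) (fun x => W (-x) + W x) g := by
    simp [multiplesSum]
  have h2 : ∑ x, (W (-x) + W x) = 2 * ∑ x, W x := by
    have := Equiv.sum_comp (Equiv.neg (ZMod N)) W
    simp only [Equiv.neg_apply] at this
    rw [Finset.sum_add_distrib, this, two_mul]
  rw [← zetaReal_eq_tsum (by linarith), h2] at h
  rw [h1]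
  nlinarith

/-- One step of the component-by-component construction. -/
theorem exists_gridSum_snoc_le (hN : 2 ≤ N) (hα : 1 / 2 < α) {d : ℕ} {γ : Fin (d + 1) → ℝ}
    (hγ : ∀ j, 0 < γ j) {φ : ZMod N → ℝ} (hφ : ∀ x, |φ x| ≤ 1) (hφ0 : φ 0 = 1) {p : ℝ}
    (hp1 : p ≤ 1) (hαp : 1 / 2 < α * p) (z : Fin d → ZMod N) :
    ∃ g : ZMod N, g ≠ 0 ∧ ∃ T : ℝ, 0 ≤ T ∧
      gridSum φ (fun j => residueWeight N α (γ j)) (Fin.snoc (α := fun _ => ZMod N) z g) ≤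
        gridSum φ (fun j : Fin d => residueWeight N α (γ j.castSucc)) z + T ∧
      ((N : ℝ) - 1) * T ^ p ≤ 2 * zetaReal (2 * (α * p)) * γ (Fin.last d) ^ p *
        ∏ j : Fin d, (1 + 2 * zetaReal (2 * (α * p)) * γ j.castSucc ^ p) := by
  have hp : 0 < p := pos_of_mul_pos_right (by linarith : 0 < α * p) (by linarith)
  have hγp : ∀ j, 0 < γ j ^ p := fun j => Real.rpow_pos_of_pos (hγ j) p
  have hρ : ∀ j c, 0 ≤ residueWeight N α (γ j) c := fun j c => residueWeight_nonneg (hγ j) c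
  have hN1 : (0 : ℝ) ≤ N - 1 := by
    have : (2 : ℝ) ≤ N := by exact_mod_cast hN
    linarith
  -- The averaging is applied to the weights already raised to the power `p`, so this `g` may depend
  -- on `p`.
  obtain ⟨g, hg, h⟩ := exists_sum_excessWeight_le hN hαp (hγp (Fin.last d))
    (W := dualWeight (fun j : Fin d => residueWeight N (α * p) (γ j.castSucc ^ p)) z)
    fun c => dualWeight_nonneg (fun j c => residueWeight_nonneg (hγp _) c) z c
  have hW : ∀ x, 0 ≤ dualWeight (fun j : Fin d => residueWeight N α (γ j.castSucc)) z x :=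
    dualWeight_nonneg (fun j c => hρ _ c) z
  refine ⟨g, hg, _, ?_, gridSum_succ_le hφ hφ0 hρ (fun c => excessWeight_nonneg (hγ (Fin.last d)) c)
    (fun c => residueWeight_eq hα (hγ _) c) z g, ?_⟩
  · exact Finset.sum_nonneg fun b _ => mul_nonneg (excessWeight_nonneg (hγ _) b) (hW _)
  · rw [sum_dualWeight] at h
    simp only [sum_residueWeight hαp (hγp _)] at h
    refine (mul_le_mul_of_nonneg_left ?_ hN1).trans h
    refine (rpow_sum_le_sum_rpow _ (fun b =>
      mul_nonneg (excessWeight_nonneg (hγ _) b) (hW _)) hp hp1).trans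
        (Finset.sum_le_sum fun b _ => ?_)
    rw [Real.mul_rpow (excessWeight_nonneg (hγ _) b) (hW _)]
    exact mul_le_mul (tsum_ite_r_rpow_le hp1 hαp hα (hγ _) _)
      (dualWeight_rpow_le (fun j c => hρ _ c) hp hp1
        (fun j c => tsum_ite_r_rpow_le hp1 hαp hα (hγ _) _) z _)
      (Real.rpow_nonneg (hW _) p) (excessWeight_nonneg (hγp _) b)

end ExcessWeight

/-! ### Existence and error bound of component-by-component vectors -/

section ComponentByComponent

variable {s N : ℕ}

theorem exists_isCBC (hN : 2 ≤ N) (err : (d : ℕ) → d ≤ s → (Fin d → ℕ) → ℝ≥0∞) :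
    ∃ g : Fin s → ℕ, IsCBC s N err g := by
  suffices h : ∀ e ≤ s, ∃ g : Fin s → ℕ, ∀ (d : ℕ) (hd : d < s), d < e →
      g ⟨d, hd⟩ ∈ Finset.Icc 1 (N - 1) ∧ ∀ z ∈ Finset.Icc 1 (N - 1),
        err (d + 1) hd (fun i => g (Fin.castLE hd i)) ≤
          err (d + 1) hd (Fin.snoc (α := fun _ => ℕ) (fun i : Fin d => g (Fin.castLE hd.le i)) z) by
    obtain ⟨g, hg⟩ := h s le_rfl
    exact ⟨g, fun d hd => hg d hd hd⟩
  intro e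
  induction e with
  | zero => exact fun _ => ⟨fun _ => 1, fun d _ h => absurd h (Nat.not_lt_zero d)⟩
  | succ e ih =>
    intro he
    obtain ⟨g, hg⟩ := ih (Nat.le_of_succ_le he)
    obtain ⟨z₀, hz₀, hmin⟩ := Finset.exists_min_image (Finset.Icc 1 (N - 1))
      (fun z => err (e + 1) he
        (Fin.snoc (α := fun _ => ℕ) (fun i : Fin e => g (Fin.castLE (Nat.le_of_succ_le he) i)) z))
      ⟨1, by simp; omega⟩
    refine ⟨Function.update g ⟨e, he⟩ z₀, fun d hd hde => ?_⟩
    have hpre : ∀ (k : ℕ) (hk : k ≤ s), k ≤ e →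
        (fun i : Fin k => Function.update g ⟨e, he⟩ z₀ (Fin.castLE hk i)) =
          fun i => g (Fin.castLE hk i) := fun k hk hke => by
      funext i
      refine Function.update_of_ne (fun h => ?_) _ _
      have := congrArg Fin.val h
      simp only [Fin.val_castLE] at this
      omega
    rcases Nat.lt_succ_iff_lt_or_eq.mp hde with h | rfl
    · rw [hpre d hd.le h.le, hpre (d + 1) hd h, Function.update_of_ne (by simp; omega)]
      exact hg d hd h
    · have hsn : (fun i : Fin (d + 1) => Function.update g ⟨d, he⟩ z₀ (Fin.castLE hd i)) =
          Fin.snoc (α := fun _ => ℕ) (fun i : Fin d => g (Fin.castLE hd.le i)) z₀ := by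
        funext i
        refine Fin.lastCases ?_ (fun i => ?_) i
        · rw [Fin.snoc_last]
          exact Function.update_self ..
        · rw [Fin.snoc_castSucc]
          exact congrFun (hpre d hd.le le_rfl) i
      rw [hpre d hd.le le_rfl, hsn, Function.update_self]
      exact ⟨hz₀, hmin⟩

/-- The minimizing component is at least as good as the one found by averaging. With `A` the product
in dimension `d`, subadditivity gives the bound `(A - 1) + 2 ζ γ ^ p * A`, which is the next product
minus 1. -/
theorem IsCBC.gridSum_rpow_le [NeZero N] (hN : 2 ≤ N) {α : ℝ} (hα : 1 / 2 < α) {γ : Fin s → ℝ}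
    (hγ : ∀ j, 0 < γ j) {φ : ZMod N → ℝ} (hφ : ∀ x, |φ x| ≤ 1) (hφ0 : φ 0 = 1)
    {err : (d : ℕ) → d ≤ s → (Fin d → ℕ) → ℝ≥0∞}
    (herr : ∀ d (h : d ≤ s) (z : Fin d → ℕ),
      0 ≤ gridSum φ (fun j => residueWeight N α (γ (Fin.castLE h j))) (fun j => (z j : ZMod N)) - 1 ∧
      err d h z = ENNReal.ofReal √(gridSum φ (fun j => residueWeight N α (γ (Fin.castLE h j)))
        (fun j => (z j : ZMod N)) - 1))
    {g : Fin s → ℕ} (hg : IsCBC s N err g) {p : ℝ} (hp1 : p ≤ 1) (hαp : 1 / 2 < α * p)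
    (d : ℕ) (hd : d ≤ s) :
    ((N : ℝ) - 1) * (gridSum φ (fun j : Fin d => residueWeight N α (γ (Fin.castLE hd j)))
        (fun j => (g (Fin.castLE hd j) : ZMod N)) - 1) ^ p ≤
      ∏ j : Fin d, (1 + 2 * zetaReal (2 * (α * p)) * γ (Fin.castLE hd j) ^ p) - 1 := by
  have hp : 0 < p := pos_of_mul_pos_right (by linarith : 0 < α * p) (by linarith)
  have hN1 : (0 : ℝ) ≤ N - 1 := by
    have : (2 : ℝ) ≤ N := by exact_mod_cast hN
    linarith
  induction d with
  | zero => simp [gridSum_fin_zero, Real.zero_rpow hp.ne']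
  | succ d ih =>
    obtain ⟨x, hx, T, hT, hle, hTp⟩ := exists_gridSum_snoc_le hN hα
      (γ := fun j => γ (Fin.castLE hd j)) (fun j => hγ _) hφ hφ0 hp1 hαp
      fun j : Fin d => (g (Fin.castLE (Nat.le_of_succ_le hd) j) : ZMod N)
    have hxmem : x.val ∈ Finset.Icc 1 (N - 1) := by
      have h1 := ZMod.val_lt x
      have h2 : x.val ≠ 0 := fun h => hx ((ZMod.val_eq_zero x).mp h)
      rw [Finset.mem_Icc]
      omega
    have hmin := (hg d hd).2 x.val hxmem
    obtain ⟨hn1, he1⟩ := herr (d + 1) hd fun i => g (Fin.castLE hd i)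
    obtain ⟨hn2, he2⟩ := herr (d + 1) hd
      (Fin.snoc (α := fun _ => ℕ) (fun i : Fin d => g (Fin.castLE (Nat.le_of_succ_le hd) i)) x.val)
    -- Nonnegativity of the squared errors turns the comparison of criteria into one of `gridSum`
    -- values, without truncation by `ENNReal.ofReal`.
    rw [he1, he2, ENNReal.ofReal_le_ofReal_iff (Real.sqrt_nonneg _), Real.sqrt_le_sqrt_iff hn2]
      at hmin
    have hsn : (fun j : Fin (d + 1) => ((Fin.snoc (α := fun _ => ℕ)
        (fun i : Fin d => g (Fin.castLE (Nat.le_of_succ_le hd) i)) x.val : Fin (d + 1) → ℕ) j :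
          ZMod N)) = Fin.snoc (α := fun _ => ZMod N)
            (fun j : Fin d => (g (Fin.castLE (Nat.le_of_succ_le hd) j) : ZMod N)) x := by
      funext j
      refine Fin.lastCases ?_ (fun j => ?_) j
      · simp
      · simp
    rw [hsn] at hmin
    have hE := (herr d (Nat.le_of_succ_le hd) fun i => g (Fin.castLE (Nat.le_of_succ_le hd) i)).1
    have hi := ih (Nat.le_of_succ_le hd)
    rw [Fin.prod_univ_castSucc]
    set E := gridSum φ (fun j : Fin d => residueWeight N α (γ (Fin.castLE (Nat.le_of_succ_le hd) j)))
        (fun j => (g (Fin.castLE (Nat.le_of_succ_le hd) j) : ZMod N)) - 1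
    set A := ∏ j : Fin d, (1 + 2 * zetaReal (2 * (α * p)) *
      γ (Fin.castLE (Nat.le_of_succ_le hd) j) ^ p)
    have hstep : gridSum φ (fun j : Fin (d + 1) => residueWeight N α (γ (Fin.castLE hd j)))
        (fun j => (g (Fin.castLE hd j) : ZMod N)) - 1 ≤ E + T := by
      refine hmin.trans ?_
      have : gridSum φ (fun j : Fin (d + 1) => residueWeight N α (γ (Fin.castLE hd j))) _ ≤
        (E + 1) + T := hle.trans (le_of_eq (by simp [E]))
      linarith
    have h3 := (Real.rpow_le_rpow hn1 hstep hp.le).trans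
      (Real.rpow_add_le_add_rpow hE hT hp.le hp1)
    have h4 := mul_le_mul_of_nonneg_left h3 hN1
    have h5 : ((N : ℝ) - 1) * T ^ p ≤
      2 * zetaReal (2 * (α * p)) * γ (Fin.castLE hd (Fin.last d)) ^ p * A := hTp
    change _ ≤ A * _ - 1
    linarith

end ComponentByComponent

/-- Expanding the product over subsets, the empty set accounts for the 1 that is subtracted. -/
theorem boundConst_eq {s : ℕ} {α : ℝ} {γ : Fin s → ℝ} (hγ : ∀ j, 0 < γ j) (τ : ℝ) :
    boundConst α γ τ =
      (-1 + ∏ j, (1 + 2 * zetaReal (2 * α / τ) * γ j ^ (1 / τ))) ^ (τ / 2) := by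
  classical
  unfold boundConst
  congr 1
  rw [Finset.prod_one_add, Finset.powerset_univ,
    ← Finset.sum_filter_add_sum_filter_not Finset.univ (fun u : Finset (Fin s) => u.Nonempty)]
  have h1 : ∑ u : Finset (Fin s) with ¬ u.Nonempty,
      ∏ j ∈ u, 2 * zetaReal (2 * α / τ) * γ j ^ (1 / τ) = 1 := by
    have : (Finset.univ.filter fun u : Finset (Fin s) => ¬ u.Nonempty) = {∅} := by
      ext u
      simp [Finset.not_nonempty_iff_eq_empty]
    rw [this]
    simp
  rw [h1, neg_add_eq_sub, add_sub_cancel_right]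
  refine Finset.sum_congr rfl fun u _ => ?_
  rw [Finset.prod_mul_distrib, Finset.prod_const, ← Real.finsetProd_rpow _ _ fun j _ => (hγ j).le,
    mul_comm]

theorem one_lt_prod_one_add_zetaReal {s : ℕ} (hs : 1 ≤ s) {α τ : ℝ} (hτ : 1 ≤ τ) (hτα : τ < 2 * α)
    {γ : Fin s → ℝ} (hγ : ∀ j, 0 < γ j) :
    1 < ∏ j, (1 + 2 * zetaReal (2 * α / τ) * γ j ^ (1 / τ)) := by
  have hζ : 0 < zetaReal (2 * α / τ) :=
    zetaReal_pos ((one_lt_div (by linarith)).mpr hτα)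
  have h : ∀ j, 1 < 1 + 2 * zetaReal (2 * α / τ) * γ j ^ (1 / τ) := fun j => by
    have := Real.rpow_pos_of_pos (hγ j) (1 / τ)
    have : 0 < 2 * zetaReal (2 * α / τ) * γ j ^ (1 / τ) := by positivity
    linarith
  have := Finset.prod_lt_prod_of_nonempty (s := Finset.univ) (f := fun _ : Fin s => (1 : ℝ))
    (fun _ _ => one_pos) (fun j _ => h j) ⟨⟨0, hs⟩, Finset.mem_univ _⟩
  simpa using this

theorem cosError_le_of_gridSum_rpow_le {s N : ℕ} [NeZero N] (hs : 1 ≤ s) (hN : 2 ≤ N) {α : ℝ}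
    (hα : 1 / 2 < α) {γ : Fin s → ℝ} (hγ : ∀ j, 0 < γ j) {g : Fin s → ℕ} {φ : ZMod N → ℝ}
    (hφ : gridSum charCos (fun j => residueWeight N α (γ j)) (fun j => (g j : ZMod N)) ≤
      gridSum φ (fun j => residueWeight N α (γ j)) (fun j => (g j : ZMod N)))
    {τ : ℝ} (hτ : 1 ≤ τ) (hτα : τ < 2 * α)
    (h : ((N : ℝ) - 1) * (gridSum φ (fun j => residueWeight N α (γ j))
      (fun j => (g j : ZMod N)) - 1) ^ (1 / τ) ≤
        ∏ j, (1 + 2 * zetaReal (2 * α / τ) * γ j ^ (1 / τ)) - 1) :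
    cosError N hα hγ g ≤ ENNReal.ofReal (boundConst α γ τ * ((N : ℝ) - 1) ^ (-τ / 2)) := by
  have hN1 : (0 : ℝ) < N - 1 := by
    have : (2 : ℝ) ≤ N := by exact_mod_cast hN
    linarith
  have hA := one_lt_prod_one_add_zetaReal hs hτ hτα hγ
  obtain ⟨h0, he⟩ := cosError_eq (N := N) hα hγ g
  rw [he, boundConst_eq hγ]
  refine ENNReal.ofReal_le_ofReal ?_
  set A := ∏ j, (1 + 2 * zetaReal (2 * α / τ) * γ j ^ (1 / τ))
  set E := gridSum φ (fun j => residueWeight N α (γ j)) (fun j => (g j : ZMod N)) - 1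
  have hE : 0 ≤ E := by linarith
  have hτ0 : 0 < τ := by linarith
  have h1 : E ^ (1 / τ) ≤ (-1 + A) / (N - 1) := by
    rw [le_div_iff₀ hN1]
    linarith
  calc √(gridSum charCos (fun j => residueWeight N α (γ j)) (fun j => (g j : ZMod N)) - 1)
      ≤ √E := Real.sqrt_le_sqrt (by linarith)
    _ = (E ^ (1 / τ)) ^ (τ / 2) := by
      rw [← Real.rpow_mul hE, Real.sqrt_eq_rpow]
      congr 1
      field_simp
    _ ≤ ((-1 + A) / (N - 1)) ^ (τ / 2) :=
      Real.rpow_le_rpow (Real.rpow_nonneg hE _) h1 (by linarith)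
    _ = (-1 + A) ^ (τ / 2) * ((N : ℝ) - 1) ^ (-τ / 2) := by
      rw [Real.div_rpow (by linarith) hN1.le, neg_div, Real.rpow_neg hN1.le, div_eq_mul_inv]

end TentLattice

end

theorem mainTheorem4 (s N : ℕ) (hs : 1 ≤ s) (hN : 2 ≤ N) (α : ℝ) (hα : 1 / 2 < α)
    (γ : Fin s → ℝ) (hγ : ∀ j, 0 < γ j) :
    (∃ g : Fin s → ℕ, TentLattice.IsKorCBC N hα hγ g) ∧
    (∃ g : Fin s → ℕ, TentLattice.IsCosCBC N hα hγ g) ∧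
    (∀ g : Fin s → ℕ, TentLattice.IsKorCBC N hα hγ g ∨ TentLattice.IsCosCBC N hα hγ g →
      (∀ j, 1 ≤ g j ∧ g j ≤ N - 1) ∧
      ∀ τ : ℝ, 1 ≤ τ → τ < 2 * α →
        TentLattice.cosError N hα hγ g ≤
          ENNReal.ofReal (TentLattice.boundConst α γ τ * ((N : ℝ) - 1) ^ (-τ / 2))) ∧
    (∀ τ : ℝ, 1 ≤ τ → τ < 2 * α →
      0 < TentLattice.boundConst α γ τ ∧
      TentLattice.boundConst α γ τ =
        (-1 + ∏ j, (1 + 2 * TentLattice.zetaReal (2 * α / τ) * γ j ^ (1 / τ))) ^ (τ / 2)) := by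
  have : NeZero N := ⟨by omega⟩
  have hmem : ∀ {err : (d : ℕ) → d ≤ s → (Fin d → ℕ) → ℝ≥0∞} {g : Fin s → ℕ},
      TentLattice.IsCBC s N err g → ∀ j, 1 ≤ g j ∧ g j ≤ N - 1 :=
    fun h j => Finset.mem_Icc.mp (h j j.2).1
  refine ⟨TentLattice.exists_isCBC hN _, TentLattice.exists_isCBC hN _, fun g hg =>
    ⟨hg.elim hmem hmem, fun τ hτ hτα => ?_⟩, fun τ hτ hτα =>
    ⟨?_, TentLattice.boundConst_eq hγ τ⟩⟩
  -- The exponent is `p = 1 / τ`: `1 ≤ τ` gives `p ≤ 1`, and `τ < 2 * α` gives `1 / 2 < α * p`.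
  · have hτ0 : 0 < τ := by linarith
    have hp1 : 1 / τ ≤ 1 := (div_le_one hτ0).mpr hτ
    have hαp : 1 / 2 < α * (1 / τ) := by
      rw [mul_one_div, lt_div_iff₀ hτ0]
      linarith
    have harg : 2 * (α * (1 / τ)) = 2 * α / τ := by ring
    rcases hg with hg | hg
    · have h := TentLattice.IsCBC.gridSum_rpow_le hN hα hγ (φ := fun _ => 1) (by simp) rfl
        (fun d h z => TentLattice.korError_eq hα (fun j => hγ (Fin.castLE h j)) z) hg hp1 hαp s le_rfl
      rw [harg] at h
      exact TentLattice.cosError_le_of_gridSum_rpow_le hs hN hα hγ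
        (TentLattice.gridSum_le_gridSum_one TentLattice.abs_charCos_le
          (fun j c => TentLattice.residueWeight_nonneg (hγ j) c) _) hτ hτα h
    · have h := TentLattice.IsCBC.gridSum_rpow_le hN hα hγ TentLattice.abs_charCos_le
        TentLattice.charCos_zero
        (fun d h z => TentLattice.cosError_eq hα (fun j => hγ (Fin.castLE h j)) z) hg hp1 hαp s le_rfl
      rw [harg] at h
      exact TentLattice.cosError_le_of_gridSum_rpow_le hs hN hα hγ le_rfl hτ hτα h
  · rw [TentLattice.boundConst_eq hγ]
    have := TentLattice.one_lt_prod_one_add_zetaReal hs hτ hτα hγ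
    exact Real.rpow_pos_of_pos (by linarith) _
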